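/- Let $\mathcal X$ be a countable discrete alphabet. Let $X=(X_1,X_2,\dots)$ be an $\mathcal X$-valued process on a probability space, with law $P_0$ (the null hypothesis), let $X^t=(X_1,\dots,X_t)$, and let $\mathcal F_t=\sigma(X_1,\dots,X_t)$. Write $P_0(x^t)$ for the probability that $X^t=x^t$. For a code length $\ell$ on finite strings, with $\exp(-\infty)=0$, put $$E_t=\frac{\exp(-\ell(X^t))}{P_0(X^t)}\quad(t\ge 0),$$ with value $0$ at strings of $P_0$-probability $0$. An E-process is a nonnegative supermartingale with respect to $(\mathcal F_t)$ under the null with $\mathbb E[E_0]\le 1$. (a) If $\ell(x^n)=-\log Q(x^n)$ for a probability measure $Q$ on $\mathcal X^{\mathbb N}$, where $Q(x^n)$ is the probability under $Q$ of starting with $x^n$, then $(E_t)$ is an E-process. (b) For a model class $\{P_\theta\}$, the NML code is $\ell(x^n)=-\log\big(\sup_\theta P_\theta(x^n)/C_n\big)$ with $C_n=\sum_{x^n}\sup_\theta P_\theta(x^n)$. With this code, $(E_t)$ is in general not a supermartingale. Precisely, let $\mathcal X=\{0,1\}$ and take the i.i.d. Bernoulli class $\{P_\theta:\theta\in[0,1]\}$.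 Then $C_n$ depends on $n$: $C_n\ne C_{n+1}$ for some $n\ge1$. Moreover, there are no kernels $q(\cdot\mid x^{t-1})\ge0$, depending only on the past string and with $\sum_{x}q(x\mid x^{t-1})\le 1$, such that $\exp(-\ell(x^t))=\exp(-\ell(x^{t-1}))\,q(x_t\mid x^{t-1})$ for all $t\ge 1$ and all strings $x^t$. Finally, $(E_t)$ is not a supermartingale when $P_0$ is the law of independent fair coin flips, nor for any other null $P_0$ that gives every finite string positive probability. (c) Let $\mathcal X$ be an effectively encoded alphabet with at least two symbols. Let $m$ be a universal semimeasure, that is, a lower semicomputable function $m\ge0$ on finite strings with $m(\varepsilon)\le1$ and $\sum_{a\in\mathcal X}m(xa)\le m(x)$ for all $x$, such that every lower semicomputable $\nu\ge0$ with these two properties satisfies $c\,\nu\le m$ for some constant $c>0$. If $\ell=-\log m$, then $E_n=m(X^n)/P_0(X^n)$ is an E-process for every null $P_0$. It is not computable: no algorithm approximates the real number $m(x)/P_0(x)$ (taken to be $0$ if $P_0(x)=0$) to every prescribed precision, uniformly in the finite string $x$. -/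

import Mathlib

open MeasureTheory ProbabilityTheory Filter
open scoped ENNReal NNReal

noncomputable section

/-! ## E-processes -/

/-- An E-process for the null `P`: a nonnegative adapted process that is a supermartingale under `P`
and whose initial expectation is at most one. -/
structure IsEProcess {Ω : Type*} [MeasurableSpace Ω] (E : ℕ → Ω → ℝ)
    (ℱ : Filtration ℕ ‹MeasurableSpace Ω›) (P : Measure Ω) : Prop where
  nonneg : ∀ t ω, 0 ≤ E t ω
  supermartingale : Supermartingale E ℱ P
  initial_le_one : ∫ ω, E 0 ω ∂P ≤ 1

/-! ## Data sequences over a discrete alphabet -/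

/-- The string `x^n = (x_0, …, x_{n-1})` of the first `n` symbols of an infinite sequence. -/
def seqPrefix {α : Type*} (x : ℕ → α) (n : ℕ) : List α :=
  List.ofFn fun i : Fin n => x i

/-- The probability `P(x^n)` that an infinite sequence with law `P` starts with a given string. -/
def stringProb {α : Type*} [MeasurableSpace α] (P : Measure (ℕ → α)) (xs : List α) : ℝ≥0∞ :=
  P {x | seqPrefix x xs.length = xs}

/-- The filtration of the data: `ℱ_t` is generated by the first `t` observations (so `ℱ_0` is
trivial). -/
def dataFiltration {Ω α : Type*} [mΩ : MeasurableSpace Ω] [MeasurableSpace α] (X : ℕ → Ω → α)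
    (hX : ∀ i, Measurable (X i)) : Filtration ℕ mΩ where
  seq t := MeasurableSpace.comap (fun ω (i : Fin t) => X i ω) MeasurableSpace.pi
  mono' := by
    intro s t hst
    rw [← measurable_iff_comap_le]
    have h : Measurable[MeasurableSpace.comap (fun ω (i : Fin t) => X i ω) MeasurableSpace.pi]
        (fun ω (i : Fin t) => X i ω) := comap_measurable _
    exact (measurable_pi_lambda (fun (y : Fin t → α) (i : Fin s) => y (Fin.castLE hst i))
      fun i => measurable_pi_apply _).comp h
  le' := by
    intro t
    rw [← measurable_iff_comap_le]
    exact measurable_pi_lambda _ fun i => hX i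

/-! ## Codes and code-to-E conversion -/

/-- The code length `ℓ(x^n) = -log w(x^n)` of a string weight `w` (infinite where `w` vanishes). -/
def logCode {α : Type*} (w : List α → ℝ≥0∞) : List α → EReal :=
  fun xs => -ENNReal.log (w xs)

/-- The ratio `exp(-ℓ(x^n)) / P₀(x^n)` as a function of the string `x^n`. Its value is `0` by
convention at strings of `P₀`-probability zero, which almost surely do not occur. -/
def codeRatio {α : Type*} [MeasurableSpace α] (ℓ : List α → EReal) (P₀ : Measure (ℕ → α))
    (xs : List α) : ℝ :=
  (EReal.exp (-ℓ xs)).toReal / (stringProb P₀ xs).toReal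

/-- The process `E_t = exp(-ℓ(X^t)) / P₀(X^t)`. -/
def codeProcess {Ω α : Type*} [MeasurableSpace α] (ℓ : List α → EReal) (P₀ : Measure (ℕ → α))
    (X : ℕ → Ω → α) (t : ℕ) (ω : Ω) : ℝ :=
  codeRatio ℓ P₀ (seqPrefix (fun i => X i ω) t)

/-- `exp(-ℓ)` factorizes sequentially: there are sub-probability kernels `q(· | x^{t-1})`, depending
on the past string only, with `exp(-ℓ(x^t)) = exp(-ℓ(x^{t-1})) q(x_t | x^{t-1})`. -/
def SequentiallyFactorizes {α : Type*} (ℓ : List α → EReal) : Prop :=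
  ∃ q : List α → α → ℝ≥0∞, (∀ xs, ∑' a, q xs a ≤ 1) ∧
    ∀ xs a, EReal.exp (-ℓ (xs ++ [a])) = EReal.exp (-ℓ xs) * q xs a

/-! ## Normalized maximum likelihood -/

/-- The maximized likelihood `sup_θ P_θ(x^n)`. -/
def maxLikelihood {Θ α : Type*} [MeasurableSpace α] (M : Θ → Measure (ℕ → α)) (xs : List α) :
    ℝ≥0∞ :=
  ⨆ θ, stringProb (M θ) xs

/-- The Shtarkov normalizing constant `C_n = ∑_{x^n} sup_θ P_θ(x^n)`. -/
def nmlNormalizer {Θ α : Type*} [MeasurableSpace α] (M : Θ → Measure (ℕ → α)) (n : ℕ) : ℝ≥0∞ :=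
  ∑' v : Fin n → α, maxLikelihood M (List.ofFn v)

/-- The NML distribution `sup_θ P_θ(x^n) / C_n` at sample size `n`, on strings of all lengths `n`. -/
def nml {Θ α : Type*} [MeasurableSpace α] (M : Θ → Measure (ℕ → α)) (xs : List α) : ℝ≥0∞ :=
  maxLikelihood M xs / nmlNormalizer M xs.length

/-- The law of an i.i.d. sequence of binary symbols that are `true` with probability `θ`. -/
def bernoulliSeq (θ : unitInterval) : Measure (ℕ → Bool) :=
  Measure.infinitePi fun _ : ℕ => bernoulliMeasure true false θ

/-- The law of a sequence of independent fair coin flips. -/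
def fairCoin : Measure (ℕ → Bool) :=
  bernoulliSeq ⟨1 / 2, by norm_num, by norm_num⟩

/-! ## Universal semimeasure and computability -/

/-- A (continuous) semimeasure on strings: `ν(ε) ≤ 1` and `∑_a ν(xa) ≤ ν(x)`. -/
def IsSemimeasure {α : Type*} (ν : List α → ℝ≥0∞) : Prop :=
  ν [] ≤ 1 ∧ ∀ xs, ∑' a, ν (xs ++ [a]) ≤ ν xs

/-- Lower semicomputability: the rational numbers below `ν(x)` are recursively enumerable,
uniformly in `x`. -/
def LowerSemicomputable {β : Type*} [Primcodable β] (ν : β → ℝ≥0∞) : Prop :=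
  REPred fun p : β × ℕ × ℕ => (p.2.1 : ℝ≥0∞) / ((p.2.2 : ℝ≥0∞) + 1) < ν p.1

/-- A universal semimeasure: a lower semicomputable semimeasure that dominates every lower
semicomputable semimeasure up to a positive multiplicative constant. -/
structure IsUniversalSemimeasure {α : Type*} [Primcodable α] (m : List α → ℝ≥0∞) : Prop where
  isSemimeasure : IsSemimeasure m
  lowerSemicomputable : LowerSemicomputable m
  dominates : ∀ ν : List α → ℝ≥0∞, IsSemimeasure ν → LowerSemicomputable ν →
    ∃ c : ℝ≥0, 0 < c ∧ ∀ xs, (c : ℝ≥0∞) * ν xs ≤ m xs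

/-- A real-valued function is computable if an algorithm outputs, for every argument `x` and every
precision `n`, a rational number `(a - b) / (n + 1)` within `1 / (n + 1)` of `f(x)`. -/
def ComputableRealFun {β : Type*} [Primcodable β] (f : β → ℝ) : Prop :=
  ∃ g : β × ℕ → ℕ × ℕ, Computable g ∧
    ∀ x n, |f x - (((g (x, n)).1 : ℝ) - ((g (x, n)).2 : ℝ)) / ((n : ℝ) + 1)| ≤ 1 / ((n : ℝ) + 1)

end

/-! Multiplying `E_t` by the null probability of a string cancels the denominator. On the event `X^t
= y` the integral of `E_{t+1}` is therefore the sum of `w(ya)` over the extensions of positive null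
probability, where `w = exp(-ℓ)`, and the integral of `E_t` is `w(y)` if `P₀(y) > 0`. Hence every
semimeasure `w` gives an E-process (`isEProcess_codeProcess`), which covers (a) and the first half
of (c). Conversely, under a null of full support a supermartingale forces `∑ a, w(ya) ≤ w(y)`
(`tsum_append_le_of_supermartingale`). A sequential factorization forces the same inequality. The
Bernoulli NML weight violates it at the string `10`, where `1/10 < 4/39`, and this refutes both
properties.

For noncomputability, suppose `R = m/P₀` is computable; nothing is assumed about the computability
of `P₀`. Since `m` is positive and lower semicomputable, so is `P₀ = m · R⁻¹` as a lower
semicomputable function. Strings of one length have total probability one, so `1 - P₀` is lower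
semicomputable too (`otherProb`). Where `P₀(x) > 0`, the identity `m = R · (1 - otherProb)` then
makes upper bounds on `m` enumerable.

A bounded semimeasure cannot lose a fixed amount `ε` at every step of an infinite path, so a search
finds `x` and `b` with `m(x) < ε + m(xb)`; any other symbol `a` then has `m(xa) < ε`
(`exists_computable_le`). This computes strings `z_k` with `m(z_k) ≤ 2^{-(k+1)}/(k+1)`. The mixture
of point masses at the `z_k` with weights `2^{-(k+1)}` is a lower semicomputable semimeasure that
`m` fails to dominate, a contradiction. -/

/-! ## Recursively enumerable predicates -/

section REPred

variable {β γ : Type*} [Primcodable β] [Primcodable γ]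

/-- The projection of a computable relation is recursively enumerable. -/
theorem ComputablePred.exists_nat {q : β × ℕ → Prop} (hq : ComputablePred q) :
    REPred fun x => ∃ n, q (x, n) := by
  classical
  have h : Partrec fun x : β => Nat.rfind fun n => Part.some (decide (q (x, n))) :=
    Partrec.rfind hq.decide.partrec
  refine h.dom_re.of_eq fun x => ?_
  refine Nat.rfind_dom.trans ⟨?_, ?_⟩
  · rintro ⟨n, hn, -⟩
    exact ⟨n, by simpa using hn⟩
  · rintro ⟨n, hn⟩
    exact ⟨n, by simpa using hn, fun _ => trivial⟩

/-- A recursively enumerable predicate is the increasing union of a primitive recursive family of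
stages. -/
theorem REPred.exists_stage {p : β → Prop} (hp : REPred p) :
    ∃ q : β → ℕ → Prop, PrimrecRel q ∧ (∀ x n k, n ≤ k → q x n → q x k) ∧
      ∀ x, p x ↔ ∃ n, q x n := by
  -- Stage `n` runs a code for the predicate with resource bound `n`; `evaln` is primitive recursive
  -- and monotone in this bound.
  obtain ⟨c, hc⟩ := Nat.Partrec.Code.exists_code.1 hp
  refine ⟨fun x n => (Nat.Partrec.Code.evaln n c (Encodable.encode x)).isSome = true,
    ⟨inferInstance, ?_⟩, ?_, ?_⟩
  · have : Primrec fun z : β × ℕ =>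
        (Nat.Partrec.Code.evaln z.2 c (Encodable.encode z.1)).isSome :=
      Primrec.option_isSome.comp (Nat.Partrec.Code.primrec_evaln.comp
        ((Primrec.snd.pair (Primrec.const c)).pair (Primrec.encode.comp Primrec.fst)))
    simpa using this
  · intro x n k hnk h
    obtain ⟨y, hy⟩ := Option.isSome_iff_exists.1 h
    exact Option.isSome_iff_exists.2 ⟨y, Nat.Partrec.Code.evaln_mono hnk hy⟩
  · intro x
    have h1 : p x ↔ (c.eval (Encodable.encode x)).Dom := by
      rw [hc]; simp [Part.assert]
    rw [h1, Part.dom_iff_mem]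
    simp only [Nat.Partrec.Code.evaln_complete, Option.isSome_iff_exists]
    exact exists_comm

theorem REPred.comp {p : γ → Prop} (hp : REPred p) {f : β → γ} (hf : Computable f) :
    REPred fun x => p (f x) :=
  Partrec.comp hp hf

theorem PrimrecPred.to_re {p : β → Prop} (hp : PrimrecPred p) : REPred p :=
  hp.computablePred.to_re

/-- Stages increase, so two witnesses found at different stages are both present at their maximum.
-/
theorem REPred.and {p q : β → Prop} (hp : REPred p) (hq : REPred q) :
    REPred fun x => p x ∧ q x := by
  obtain ⟨p', hp', mp, ep⟩ := hp.exists_stage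
  obtain ⟨q', hq', mq, eq⟩ := hq.exists_stage
  have h : PrimrecPred fun z : β × ℕ => p' z.1 z.2 ∧ q' z.1 z.2 := PrimrecPred.and hp' hq'
  refine h.computablePred.exists_nat.of_eq fun x => ?_
  rw [ep, eq]
  constructor
  · rintro ⟨n, h1, h2⟩
    exact ⟨⟨n, h1⟩, n, h2⟩
  · rintro ⟨⟨n, h1⟩, k, h2⟩
    exact ⟨max n k, mp x _ _ (le_max_left _ _) h1, mq x _ _ (le_max_right _ _) h2⟩

theorem REPred.or {p q : β → Prop} (hp : REPred p) (hq : REPred q) :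
    REPred fun x => p x ∨ q x := by
  obtain ⟨p', hp', -, ep⟩ := hp.exists_stage
  obtain ⟨q', hq', -, eq⟩ := hq.exists_stage
  have h : PrimrecPred fun z : β × ℕ => p' z.1 z.2 ∨ q' z.1 z.2 := PrimrecPred.or hp' hq'
  refine h.computablePred.exists_nat.of_eq fun x => ?_
  rw [ep, eq]
  exact exists_or

/-- Dovetailing: one natural number codes both a candidate `y` and a stage, and numbers that decode
to no candidate count as failures. -/
theorem REPred.exists {p : β → γ → Prop} (hp : REPred fun z : β × γ => p z.1 z.2) :
    REPred fun x => ∃ y, p x y := by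
  classical
  obtain ⟨q, hq', -, eq⟩ := hp.exists_stage
  have hq : Primrec fun z : (β × γ) × ℕ => decide (q z.1 z.2) := PrimrecPred.decide hq'
  have h : Primrec fun z : β × ℕ =>
      (((Encodable.decode (α := γ) z.2.unpair.1).map fun y => decide (q (z.1, y) z.2.unpair.2)).getD
        false) := by
    refine Primrec.option_getD.comp (Primrec.option_map (Primrec.decode.comp
      (Primrec.fst.comp (Primrec.unpair.comp Primrec.snd))) ?_) (Primrec.const false)
    exact Primrec.comp (g := fun w : (β × ℕ) × γ => ((w.1.1, w.2), w.1.2.unpair.2)) hq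
      (((Primrec.fst.comp Primrec.fst).pair Primrec.snd).pair
      (Primrec.snd.comp (Primrec.unpair.comp (Primrec.snd.comp Primrec.fst))))
  have h' : ComputablePred fun z : β × ℕ => (((Encodable.decode (α := γ) z.2.unpair.1).map
      fun y => decide (q (z.1, y) z.2.unpair.2)).getD false) = true :=
    ComputablePred.computable_iff.2 ⟨_, h.to_comp, rfl⟩
  refine h'.exists_nat.of_eq fun x => ?_
  constructor
  · rintro ⟨n, hn⟩
    cases hd : Encodable.decode (α := γ) n.unpair.1 with
    | none => simp [hd] at hn
    | some y => exact ⟨y, (eq (x, y)).2 ⟨n.unpair.2, by simpa [hd] using hn⟩⟩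
  · rintro ⟨y, hy⟩
    obtain ⟨s, hs⟩ := (eq (x, y)).1 hy
    exact ⟨Nat.pair (Encodable.encode y) s, by simpa using hs⟩

theorem REPred.forall_mem_list {p : γ → β → Prop} (hp : REPred fun z : γ × β => p z.1 z.2) :
    REPred fun z : List γ × β => ∀ a ∈ z.1, p a z.2 := by
  obtain ⟨q, hq, mq, eq⟩ := hp.exists_stage
  have hR : PrimrecRel fun (a : γ) (w : β × ℕ) => q (a, w.1) w.2 :=
    PrimrecRel.comp hq (Primrec.fst.pair (Primrec.fst.comp Primrec.snd))
      (Primrec.snd.comp Primrec.snd)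
  have h : PrimrecPred fun z : (List γ × β) × ℕ => ∀ a ∈ z.1.1, q (a, z.1.2) z.2 :=
    PrimrecRel.comp hR.forall_mem_list (Primrec.fst.comp Primrec.fst)
      ((Primrec.snd.comp Primrec.fst).pair Primrec.snd)
  refine h.computablePred.exists_nat.of_eq fun ⟨L, b⟩ => ?_
  constructor
  · rintro ⟨s, hs⟩ a ha
    exact (eq (a, b)).2 ⟨s, hs a ha⟩
  · intro hL
    induction L with
    | nil => exact ⟨0, by simp⟩
    | cons a L ih =>
      obtain ⟨s, hs⟩ := ih fun a ha => hL a (List.mem_cons_of_mem _ ha)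
      obtain ⟨t, ht⟩ := (eq (a, b)).1 (hL a List.mem_cons_self)
      refine ⟨max s t, fun c hc => ?_⟩
      rcases List.mem_cons.1 hc with rfl | hc
      · exact mq _ _ _ (le_max_right _ _) ht
      · exact mq _ _ _ (le_max_left _ _) (hs c hc)

/-- Uniformization: from a recursively enumerable relation with nonempty sections, a witness can be
computed. -/
theorem REPred.exists_computable {p : β → γ → Prop} (hp : REPred fun z : β × γ => p z.1 z.2)
    (h : ∀ x, ∃ y, p x y) : ∃ f : β → γ, Computable f ∧ ∀ x, p x (f x) := by
  classical
  obtain ⟨q, hq', -, eq⟩ := hp.exists_stage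
  have hq : Primrec fun z : (β × γ) × ℕ => decide (q z.1 z.2) := PrimrecPred.decide hq'
  -- The index `n` codes a candidate and a stage; the candidate is returned only if it is verified
  -- by that stage.
  let F : β → ℕ → Option γ := fun x n => (Encodable.decode (α := γ) n.unpair.1).bind fun y =>
    bif decide (q (x, y) n.unpair.2) then some y else none
  have hF : Computable₂ F := by
    refine Primrec.to_comp (Primrec.option_bind (Primrec.decode.comp
      (Primrec.fst.comp (Primrec.unpair.comp Primrec.snd))) ?_)
    refine Primrec.cond (hq.comp (((Primrec.fst.comp Primrec.fst).pair Primrec.snd).pair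
      (Primrec.snd.comp (Primrec.unpair.comp (Primrec.snd.comp Primrec.fst)))))
      (Primrec.option_some.comp Primrec.snd) (Primrec.const none)
  have hspec : ∀ x n y, y ∈ F x n → p x y := by
    intro x n y hy
    simp only [F, Option.mem_def, Option.bind_eq_some_iff] at hy
    obtain ⟨z, -, hz⟩ := hy
    by_cases hq' : q (x, z) n.unpair.2
    · simp only [hq', decide_true, cond_true, Option.some.injEq] at hz
      exact hz ▸ (eq (x, z)).2 ⟨_, hq'⟩
    · simp [hq'] at hz
  have hdom : ∀ x, (Nat.rfindOpt (F x)).Dom := by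
    intro x
    obtain ⟨y, hy⟩ := h x
    obtain ⟨s, hs⟩ := (eq (x, y)).1 hy
    refine Nat.rfindOpt_dom.2 ⟨Nat.pair (Encodable.encode y) s, y, ?_⟩
    simp [F, hs]
  refine ⟨fun x => (Nat.rfindOpt (F x)).get (hdom x),
    (Partrec.rfindOpt hF).of_eq_tot fun x => Part.get_mem _, fun x => ?_⟩
  obtain ⟨n, hn⟩ := Nat.rfindOpt_spec (Part.get_mem (hdom x))
  exact hspec x n _ hn

end REPred

/-! ## Lower semicomputable functions -/

section LowerSemicomputable

/-- The fraction `a / (b + 1)` as an extended nonnegative real. -/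
noncomputable def natFrac (p : ℕ × ℕ) : ℝ≥0∞ := (p.1 : ℝ≥0∞) / ((p.2 : ℝ≥0∞) + 1)

theorem natFrac_eq_ofReal (p : ℕ × ℕ) :
    natFrac p = ENNReal.ofReal ((p.1 : ℝ) / ((p.2 : ℝ) + 1)) := by
  rw [natFrac, ENNReal.ofReal_div_of_pos (by positivity), ENNReal.ofReal_natCast]
  congr 1
  rw [ENNReal.ofReal_add (by positivity) zero_le_one]
  simp

theorem natFrac_ne_top (p : ℕ × ℕ) : natFrac p ≠ ∞ := by
  rw [natFrac_eq_ofReal]; exact ENNReal.ofReal_ne_top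

@[simp] theorem natFrac_zero (b : ℕ) : natFrac (0, b) = 0 := by simp [natFrac]

theorem natFrac_lt_natFrac {p q : ℕ × ℕ} :
    natFrac p < natFrac q ↔ p.1 * (q.2 + 1) < q.1 * (p.2 + 1) := by
  rw [natFrac_eq_ofReal, natFrac_eq_ofReal, ENNReal.ofReal_lt_ofReal_iff_of_nonneg (by positivity),
    div_lt_div_iff₀ (by positivity) (by positivity)]
  exact_mod_cast Iff.rfl

/-- Denominators are stored minus one, and `(b + 1)(d + 1) - 1 = bd + b + d`. -/
theorem natFrac_mul (p q : ℕ × ℕ) :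
    natFrac p * natFrac q = natFrac (p.1 * q.1, p.2 * q.2 + p.2 + q.2) := by
  simp only [natFrac_eq_ofReal]
  rw [← ENNReal.ofReal_mul (by positivity)]
  congr 1
  push_cast
  field_simp
  ring

theorem natFrac_add (p q : ℕ × ℕ) :
    natFrac p + natFrac q =
      natFrac (p.1 * (q.2 + 1) + q.1 * (p.2 + 1), p.2 * q.2 + p.2 + q.2) := by
  simp only [natFrac_eq_ofReal]
  rw [← ENNReal.ofReal_add (by positivity) (by positivity)]
  congr 1
  push_cast
  have : (p.2 : ℝ) * q.2 + p.2 + q.2 + 1 = (p.2 + 1) * (q.2 + 1) := by ring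
  rw [this]
  field_simp

theorem exists_natFrac_btwn {x y : ℝ≥0∞} (h : x < y) : ∃ p, x < natFrac p ∧ natFrac p < y := by
  obtain ⟨q, hq0, h1, h2⟩ := ENNReal.lt_iff_exists_rat_btwn.1 h
  refine ⟨(q.num.toNat, q.den - 1), ?_⟩
  have : natFrac (q.num.toNat, q.den - 1) = ((q : ℝ).toNNReal : ℝ≥0∞) := by
    rw [natFrac_eq_ofReal, ENNReal.ofReal]
    congr 2
    have hn : ((q.num.toNat : ℕ) : ℤ) = q.num := Int.toNat_of_nonneg (Rat.num_nonneg.2 hq0)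
    have hn' : ((q.num.toNat : ℕ) : ℝ) = (q.num : ℝ) := by
      exact_mod_cast congrArg (Int.cast (R := ℝ)) hn
    have hd : (((q.den - 1 : ℕ) : ℝ) + 1) = q.den := by
      exact_mod_cast Nat.sub_add_cancel q.den_pos
    simp only [hn', hd]
    exact (Rat.cast_def q).symm
  rw [this]
  exact ⟨h1, h2⟩

/-- If `v ≤ c`, any fraction between `c - v` and `u` works. Otherwise zero does; it is allowed
separately because no fraction lies strictly below `u = 0`. -/
theorem exists_natFrac_add {c u v : ℝ≥0∞} (h : c < u + v) :
    ∃ p : ℕ × ℕ, (p.1 = 0 ∨ natFrac p < u) ∧ c < natFrac p + v := by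
  by_cases hcv : c < v
  · exact ⟨(0, 0), Or.inl rfl, by simpa using hcv⟩
  · have hvc := not_lt.1 hcv
    have hv : v ≠ ∞ := ne_top_of_le_ne_top h.ne_top hvc
    obtain ⟨p, h1, h2⟩ := exists_natFrac_btwn
      (show c - v < u from (ENNReal.sub_lt_iff_lt_right hv hvc).2 h)
    exact ⟨p, Or.inr h2, (ENNReal.sub_lt_iff_lt_right hv hvc).1 h1⟩

/-- Terms are replaced by fractions one at a time; the free `v` holds the part of the sum not being
treated. -/
theorem exists_natFrac_sum {f : ℕ → ℝ≥0∞} (K : ℕ) {c v : ℝ≥0∞}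
    (h : c < ∑ i ∈ Finset.range K, f i + v) :
    ∃ w : ℕ → ℕ × ℕ, (∀ i, (w i).1 = 0 ∨ natFrac (w i) < f i) ∧
      c < ∑ i ∈ Finset.range K, natFrac (w i) + v := by
  induction K generalizing v with
  | zero => exact ⟨fun _ => (0, 0), fun _ => Or.inl rfl, by simpa using h⟩
  | succ K ih =>
    rw [Finset.sum_range_succ, add_assoc] at h
    obtain ⟨w, hw, h'⟩ := ih h
    rw [add_left_comm] at h'
    obtain ⟨p, hp, h''⟩ := exists_natFrac_add h'
    refine ⟨Function.update w K p, fun i => ?_, ?_⟩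
    · by_cases hi : i = K
      · subst hi; simpa using hp
      · simpa [hi] using hw i
    · rw [Finset.sum_range_succ, Function.update_self, add_assoc, Finset.sum_congr rfl
        (g := fun i => natFrac (w i)), add_left_comm]
      · exact h''
      · intro i hi
        rw [Function.update_of_ne (Finset.mem_range.1 hi).ne]

/-- A fraction equal to the sum of a list of fractions. -/
def natFracSum (L : List (ℕ × ℕ)) : ℕ × ℕ :=
  L.foldr (fun p q => (p.1 * (q.2 + 1) + q.1 * (p.2 + 1), p.2 * q.2 + p.2 + q.2)) (0, 0)

theorem natFrac_natFracSum (L : List (ℕ × ℕ)) : natFrac (natFracSum L) = (L.map natFrac).sum := by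
  induction L with
  | nil => simp [natFracSum]
  | cons p L ih =>
    rw [List.map_cons, List.sum_cons, ← ih, natFrac_add]
    rfl

theorem primrec_natFracSum : Primrec natFracSum := by
  refine Primrec.list_foldr (h := fun (_ : List (ℕ × ℕ)) (z : (ℕ × ℕ) × (ℕ × ℕ)) =>
    (z.1.1 * (z.2.2 + 1) + z.2.1 * (z.1.2 + 1), z.1.2 * z.2.2 + z.1.2 + z.2.2))
    Primrec.id (Primrec.const (0, 0)) ?_
  have a1 : Primrec fun w : List (ℕ × ℕ) × (ℕ × ℕ) × (ℕ × ℕ) => w.2.1.1 :=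
    Primrec.fst.comp (Primrec.fst.comp Primrec.snd)
  have b1 : Primrec fun w : List (ℕ × ℕ) × (ℕ × ℕ) × (ℕ × ℕ) => w.2.1.2 :=
    Primrec.snd.comp (Primrec.fst.comp Primrec.snd)
  have a2 : Primrec fun w : List (ℕ × ℕ) × (ℕ × ℕ) × (ℕ × ℕ) => w.2.2.1 :=
    Primrec.fst.comp (Primrec.snd.comp Primrec.snd)
  have b2 : Primrec fun w : List (ℕ × ℕ) × (ℕ × ℕ) × (ℕ × ℕ) => w.2.2.2 :=
    Primrec.snd.comp (Primrec.snd.comp Primrec.snd)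
  exact (Primrec.nat_add.comp (Primrec.nat_mul.comp a1 (Primrec.succ.comp b2))
      (Primrec.nat_mul.comp a2 (Primrec.succ.comp b1))).pair
    (Primrec.nat_add.comp (Primrec.nat_add.comp (Primrec.nat_mul.comp b1 b2) b1) b2)

theorem sum_natFrac_getD (L : List (ℕ × ℕ)) :
    (L.map natFrac).sum = ∑ i ∈ Finset.range L.length, natFrac (L.getD i (0, 0)) := by
  induction L with
  | nil => simp
  | cons p L ih => simp [Finset.sum_range_succ', ih, add_comm]

variable {β γ ι : Type*} [Primcodable β] [Primcodable γ] [Primcodable ι]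

theorem lowerSemicomputable_iff {ν : β → ℝ≥0∞} :
    LowerSemicomputable ν ↔ REPred fun z : β × (ℕ × ℕ) => natFrac z.2 < ν z.1 := Iff.rfl

/-- A function is lower semicomputable if it is the supremum of a recursively enumerable family of
fractions. -/
theorem LowerSemicomputable.of_certificates {ν : β → ℝ≥0∞} {S : β → γ → Prop} {v : γ → ℕ × ℕ}
    (hS : REPred fun z : β × γ => S z.1 z.2) (hv : Computable v)
    (sound : ∀ x w, S x w → natFrac (v w) ≤ ν x)
    (complete : ∀ x c, c < ν x → ∃ w, S x w ∧ c < natFrac (v w)) : LowerSemicomputable ν := by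
  classical
  have h1 : REPred fun z : (β × ℕ × ℕ) × γ => S z.1.1 z.2 :=
    hS.comp (f := fun z : (β × ℕ × ℕ) × γ => (z.1.1, z.2))
      ((Computable.fst.comp Computable.fst).pair Computable.snd)
  have h2 : REPred fun z : (ℕ × ℕ) × (ℕ × ℕ) => z.1.1 * (z.2.2 + 1) < z.2.1 * (z.1.2 + 1) :=
    PrimrecPred.to_re (Primrec.nat_lt.comp
      (Primrec.nat_mul.comp (Primrec.fst.comp Primrec.fst)
        (Primrec.succ.comp (Primrec.snd.comp Primrec.snd)))
      (Primrec.nat_mul.comp (Primrec.fst.comp Primrec.snd)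
        (Primrec.succ.comp (Primrec.snd.comp Primrec.fst))))
  have h3 : REPred fun z : (β × ℕ × ℕ) × γ => natFrac z.1.2 < natFrac (v z.2) := by
    simp only [natFrac_lt_natFrac]
    exact h2.comp (f := fun z : (β × ℕ × ℕ) × γ => (z.1.2, v z.2))
      ((Computable.snd.comp Computable.fst).pair (hv.comp Computable.snd))
  refine (REPred.exists (p := fun (z : β × ℕ × ℕ) w => S z.1 w ∧ natFrac z.2 < natFrac (v w))
    (h1.and h3)).of_eq fun z => ?_
  constructor
  · rintro ⟨w, hw, h⟩
    exact h.trans_le (sound _ _ hw)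
  · intro h
    exact complete _ _ h

theorem LowerSemicomputable.comp {ν : γ → ℝ≥0∞} (hν : LowerSemicomputable ν) {f : β → γ}
    (hf : Computable f) : LowerSemicomputable fun x => ν (f x) :=
  REPred.comp (lowerSemicomputable_iff.1 hν) (f := fun z : β × (ℕ × ℕ) => (f z.1, z.2))
    ((hf.comp Computable.fst).pair Computable.snd)

theorem computable_natFrac_mul : Computable fun w : (ℕ × ℕ) × (ℕ × ℕ) =>
    (w.1.1 * w.2.1, w.1.2 * w.2.2 + w.1.2 + w.2.2) := by
  have a1 : Primrec fun w : (ℕ × ℕ) × (ℕ × ℕ) => w.1.1 := Primrec.fst.comp Primrec.fst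
  have b1 : Primrec fun w : (ℕ × ℕ) × (ℕ × ℕ) => w.1.2 := Primrec.snd.comp Primrec.fst
  have a2 : Primrec fun w : (ℕ × ℕ) × (ℕ × ℕ) => w.2.1 := Primrec.fst.comp Primrec.snd
  have b2 : Primrec fun w : (ℕ × ℕ) × (ℕ × ℕ) => w.2.2 := Primrec.snd.comp Primrec.snd
  exact ((Primrec.nat_mul.comp a1 a2).pair
    (Primrec.nat_add.comp (Primrec.nat_add.comp (Primrec.nat_mul.comp b1 b2) b1) b2)).to_comp

theorem LowerSemicomputable.mul {f g : β → ℝ≥0∞} (hf : LowerSemicomputable f)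
    (hg : LowerSemicomputable g) : LowerSemicomputable fun x => f x * g x := by
  rw [lowerSemicomputable_iff] at hf hg
  refine LowerSemicomputable.of_certificates
    (S := fun x (w : (ℕ × ℕ) × (ℕ × ℕ)) => natFrac w.1 < f x ∧ natFrac w.2 < g x)
    (v := fun w => (w.1.1 * w.2.1, w.1.2 * w.2.2 + w.1.2 + w.2.2))
    (REPred.and
      (hf.comp (f := fun z : β × (ℕ × ℕ) × (ℕ × ℕ) => (z.1, z.2.1))
        (Computable.fst.pair (Computable.fst.comp Computable.snd)))
      (hg.comp (f := fun z : β × (ℕ × ℕ) × (ℕ × ℕ) => (z.1, z.2.2))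
        (Computable.fst.pair (Computable.snd.comp Computable.snd))))
    computable_natFrac_mul ?_ ?_
  · rintro x w ⟨h1, h2⟩
    rw [← natFrac_mul]
    exact mul_le_mul' h1.le h2.le
  · intro x c hc
    -- A product in `ℝ≥0∞` is the supremum of the products of strict lower bounds of its factors.
    have : ∃ a < f x, ∃ b < g x, c < a * b := by
      by_contra! h
      exact absurd (ENNReal.mul_le_of_forall_lt h) (not_le.2 hc)
    obtain ⟨a, ha, b, hb, hab⟩ := this
    obtain ⟨p, hp1, hp2⟩ := exists_natFrac_btwn ha
    obtain ⟨q, hq1, hq2⟩ := exists_natFrac_btwn hb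
    refine ⟨(p, q), ⟨hp2, hq2⟩, ?_⟩
    rw [← natFrac_mul]
    exact hab.trans_le (mul_le_mul' hp1.le hq1.le)

/-- The fractions below `f`, together with the fractions of value zero. -/
theorem LowerSemicomputable.re_zero_or_lt {f : β → ℝ≥0∞} (hf : LowerSemicomputable f) :
    REPred fun z : β × (ℕ × ℕ) => z.2.1 = 0 ∨ natFrac z.2 < f z.1 :=
  REPred.or (PrimrecPred.to_re (Primrec.eq.comp (Primrec.fst.comp Primrec.snd) (Primrec.const 0)))
    (lowerSemicomputable_iff.1 hf)

theorem natFrac_le_of_zero_or_lt {p : ℕ × ℕ} {u : ℝ≥0∞} (h : p.1 = 0 ∨ natFrac p < u) :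
    natFrac p ≤ u := by
  obtain ⟨a, b⟩ := p
  rcases h with rfl | h
  · simp
  · exact h.le

/-- A countable sum of uniformly lower semicomputable functions is lower semicomputable. -/
theorem LowerSemicomputable.tsum_nat {f : β → ℕ → ℝ≥0∞}
    (hf : LowerSemicomputable fun z : β × ℕ => f z.1 z.2) :
    LowerSemicomputable fun x => ∑' i, f x i := by
  have h1 := hf.re_zero_or_lt
  have h2 : REPred fun z : ℕ × (β × List (ℕ × ℕ)) =>
      (z.2.2.getD z.1 (0, 0)).1 = 0 ∨ natFrac (z.2.2.getD z.1 (0, 0)) < f z.2.1 z.1 :=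
    h1.comp (f := fun z : ℕ × (β × List (ℕ × ℕ)) => ((z.2.1, z.1), z.2.2.getD z.1 (0, 0)))
      (((Computable.fst.comp Computable.snd).pair Computable.fst).pair
        (((Primrec.list_getD (0, 0)).comp (Primrec.snd.comp Primrec.snd) Primrec.fst).to_comp))
  have h3 := REPred.forall_mem_list (p := fun (i : ℕ) (z : β × List (ℕ × ℕ)) =>
    (z.2.getD i (0, 0)).1 = 0 ∨ natFrac (z.2.getD i (0, 0)) < f z.1 i) h2
  -- A certificate is a finite list whose `i`-th fraction is zero or below `f x i`. Its sum bounds a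
  -- partial sum from below, and partial sums exhaust the series.
  refine LowerSemicomputable.of_certificates
    (S := fun x (L : List (ℕ × ℕ)) => ∀ i ∈ List.range L.length,
      (L.getD i (0, 0)).1 = 0 ∨ natFrac (L.getD i (0, 0)) < f x i)
    (v := natFracSum)
    (h3.comp (f := fun z : β × List (ℕ × ℕ) => (List.range z.2.length, z))
      ((Primrec.list_range.comp (Primrec.list_length.comp Primrec.snd)).to_comp.pair
        Computable.id)) primrec_natFracSum.to_comp ?_ ?_
  · intro x L hL
    rw [natFrac_natFracSum, sum_natFrac_getD]
    refine (Finset.sum_le_sum fun i hi => natFrac_le_of_zero_or_lt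
      (hL i (by simpa using hi))).trans (ENNReal.sum_le_tsum _)
  · intro x c hc
    rw [ENNReal.tsum_eq_iSup_nat, lt_iSup_iff] at hc
    obtain ⟨K, hK⟩ := hc
    obtain ⟨w, hw, h⟩ := exists_natFrac_sum (f := f x) K (v := 0) (by simpa using hK)
    have hget : ∀ i < K, ((List.range K).map w).getD i (0, 0) = w i := by
      intro i hi
      simp [hi]
    refine ⟨(List.range K).map w, ?_, ?_⟩
    · intro i hi
      rw [hget i (by simpa using hi)]
      exact hw i
    · rw [natFrac_natFracSum, sum_natFrac_getD, List.length_map, List.length_range,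
        Finset.sum_congr rfl fun i hi => congrArg natFrac (hget i (Finset.mem_range.1 hi))]
      simpa using h

/-- The family is transported to `ℕ` along the encoding and extended by zero, which leaves the sum
unchanged. -/
theorem LowerSemicomputable.tsum {f : β → ι → ℝ≥0∞}
    (hf : LowerSemicomputable fun z : β × ι => f z.1 z.2) :
    LowerSemicomputable fun x => ∑' i, f x i := by
  have h : LowerSemicomputable fun z : β × ℕ =>
      Function.extend (Encodable.encode (α := ι)) (f z.1) 0 z.2 := by
    have h1 : REPred fun z : ((β × ℕ) × (ℕ × ℕ)) × ι => Encodable.encode z.2 = z.1.1.2 :=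
      PrimrecPred.to_re (Primrec.eq.comp (Primrec.encode.comp Primrec.snd)
        (Primrec.snd.comp (Primrec.fst.comp Primrec.fst)))
    have h2 : REPred fun z : ((β × ℕ) × (ℕ × ℕ)) × ι => natFrac z.1.2 < f z.1.1.1 z.2 :=
      (lowerSemicomputable_iff.1 hf).comp
        (f := fun z : ((β × ℕ) × (ℕ × ℕ)) × ι => ((z.1.1.1, z.2), z.1.2))
        (((Computable.fst.comp (Computable.fst.comp Computable.fst)).pair Computable.snd).pair
          (Computable.snd.comp Computable.fst))
    refine (REPred.exists (p := fun (z : (β × ℕ) × (ℕ × ℕ)) (i : ι) =>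
      Encodable.encode i = z.1.2 ∧ natFrac z.2 < f z.1.1 i) (h1.and h2)).of_eq ?_
    rintro ⟨⟨x, n⟩, p⟩
    change (∃ i : ι, Encodable.encode i = n ∧ natFrac p < f x i) ↔
      natFrac p < Function.extend (Encodable.encode (α := ι)) (f x) 0 n
    constructor
    · rintro ⟨i, rfl, hi⟩
      rwa [Encodable.encode_injective.extend_apply]
    · intro hp
      by_cases hn : ∃ i : ι, Encodable.encode i = n
      · obtain ⟨i, rfl⟩ := hn
        rw [Encodable.encode_injective.extend_apply] at hp
        exact ⟨i, rfl, hp⟩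
      · rw [Function.extend_apply' _ _ _ hn] at hp
        exact absurd hp not_lt_zero
  have h' := h.tsum_nat (f := fun x n => Function.extend (Encodable.encode (α := ι)) (f x) 0 n)
  simpa only [tsum_extend_zero (Encodable.encode_injective (α := ι))] using h'

theorem LowerSemicomputable.add {f g : β → ℝ≥0∞} (hf : LowerSemicomputable f)
    (hg : LowerSemicomputable g) : LowerSemicomputable fun x => f x + g x := by
  have h : LowerSemicomputable fun z : β × Bool => bif z.2 then f z.1 else g z.1 := by
    have e (b : Bool) : REPred fun z : (β × Bool) × (ℕ × ℕ) => z.1.2 = b :=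
      PrimrecPred.to_re (Primrec.eq.comp (Primrec.snd.comp Primrec.fst) (Primrec.const b))
    have c : Computable fun z : (β × Bool) × (ℕ × ℕ) => (z.1.1, z.2) :=
      (Computable.fst.comp Computable.fst).pair Computable.snd
    refine (((e true).and ((lowerSemicomputable_iff.1 hf).comp c)).or
      ((e false).and ((lowerSemicomputable_iff.1 hg).comp c))).of_eq ?_
    rintro ⟨⟨x, b⟩, p⟩
    cases b <;> simp [natFrac]
  have h' := h.tsum (f := fun x b => bif b then f x else g x)
  simpa [tsum_bool, add_comm] using h'

/-- A computable fraction is lower semicomputable. -/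
theorem Computable.lowerSemicomputable_natFrac {v : β → ℕ × ℕ} (hv : Computable v) :
    LowerSemicomputable fun x => natFrac (v x) := by
  have h : REPred fun z : (ℕ × ℕ) × (ℕ × ℕ) => natFrac z.2 < natFrac z.1 := by
    simp only [natFrac_lt_natFrac]
    exact PrimrecPred.to_re (Primrec.nat_lt.comp
      (Primrec.nat_mul.comp (Primrec.fst.comp Primrec.snd)
        (Primrec.succ.comp (Primrec.snd.comp Primrec.fst)))
      (Primrec.nat_mul.comp (Primrec.fst.comp Primrec.fst)
        (Primrec.succ.comp (Primrec.snd.comp Primrec.snd))))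
  exact LowerSemicomputable.comp (ν := natFrac) h hv

theorem LowerSemicomputable.indicator {f : β → ℝ≥0∞} (hf : LowerSemicomputable f) {s : Set β}
    (hs : REPred fun x => x ∈ s) : LowerSemicomputable (s.indicator f) := by
  refine ((hs.comp (f := fun z : β × (ℕ × ℕ) => z.1) Computable.fst).and
    (lowerSemicomputable_iff.1 hf)).of_eq fun z => ?_
  change _ ↔ natFrac z.2 < s.indicator f z.1
  by_cases hz : z.1 ∈ s <;> simp [hz]

theorem LowerSemicomputable.re_pos {f : β → ℝ≥0∞} (hf : LowerSemicomputable f) :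
    REPred fun x => 0 < f x :=
  ((lowerSemicomputable_iff.1 hf).comp (f := fun x => (x, ((0, 0) : ℕ × ℕ)))
    (Computable.id.pair (Computable.const _))).of_eq fun x => by simp

/-- The comparison of two fractions, each the sum of two fractions, is decidable. -/
theorem computablePred_natFrac_add_lt {p q r s : β → ℕ × ℕ} (hp : Computable p)
    (hq : Computable q) (hr : Computable r) (hs : Computable s) :
    ComputablePred fun x => natFrac (p x) + natFrac (q x) < natFrac (r x) + natFrac (s x) := by
  classical
  have hadd {u v : β → ℕ × ℕ} (hu : Computable u) (hv : Computable v) :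
      Computable fun x => natFracSum [u x, v x] :=
    primrec_natFracSum.to_comp.comp (Computable.list_cons.comp hu
      (Computable.list_cons.comp hv (Computable.const [])))
  have hlt : Primrec fun z : (ℕ × ℕ) × (ℕ × ℕ) =>
      decide (z.1.1 * (z.2.2 + 1) < z.2.1 * (z.1.2 + 1)) :=
    PrimrecPred.decide (Primrec.nat_lt.comp
      (Primrec.nat_mul.comp (Primrec.fst.comp Primrec.fst)
        (Primrec.succ.comp (Primrec.snd.comp Primrec.snd)))
      (Primrec.nat_mul.comp (Primrec.fst.comp Primrec.snd)
        (Primrec.succ.comp (Primrec.snd.comp Primrec.fst))))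
  refine ComputablePred.computable_iff.2
    ⟨_, hlt.to_comp.comp ((hadd hp hq).pair (hadd hr hs)), funext fun x => propext ?_⟩
  rw [decide_eq_true_iff, ← natFrac_lt_natFrac, natFrac_natFracSum, natFrac_natFracSum]
  simp

end LowerSemicomputable

/-! ## Computable real functions -/

section ComputableRealFun

variable {β : Type*} [Primcodable β]

theorem natFrac_add_lt_natFrac_add {p q r s : ℕ × ℕ} :
    natFrac p + natFrac q < natFrac r + natFrac s ↔
      (p.1 : ℝ) / (p.2 + 1) + q.1 / (q.2 + 1) < (r.1 : ℝ) / (r.2 + 1) + s.1 / (s.2 + 1) := by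
  simp only [natFrac_eq_ofReal]
  rw [← ENNReal.ofReal_add (by positivity) (by positivity),
    ← ENNReal.ofReal_add (by positivity) (by positivity),
    ENNReal.ofReal_lt_ofReal_iff_of_nonneg (by positivity)]

/-- A strict upper bound is eventually confirmed by an approximation plus its error. The subtracted
part of the approximation is moved to the other side, so only sums of nonnegative fractions are
compared. -/
theorem ComputableRealFun.re_lt_natFrac {f : β → ℝ} (hf : ComputableRealFun f)
    (h0 : ∀ x, 0 ≤ f x) :
    REPred fun z : β × (ℕ × ℕ) => ENNReal.ofReal (f z.1) < natFrac z.2 := by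
  obtain ⟨g, hg, h⟩ := hf
  have hg' : Computable fun z : (β × (ℕ × ℕ)) × ℕ => g (z.1.1, z.2) :=
    hg.comp ((Computable.fst.comp Computable.fst).pair Computable.snd)
  refine (ComputablePred.exists_nat (computablePred_natFrac_add_lt
    (p := fun z : (β × (ℕ × ℕ)) × ℕ => ((g (z.1.1, z.2)).1, z.2)) (q := fun z => (1, z.2))
    (r := fun z => z.1.2) (s := fun z => ((g (z.1.1, z.2)).2, z.2))
    ((Computable.fst.comp hg').pair Computable.snd)
    ((Computable.const 1).pair Computable.snd) (Computable.snd.comp Computable.fst)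
    ((Computable.snd.comp hg').pair Computable.snd))).of_eq ?_
  rintro ⟨x, p⟩
  simp only [natFrac_add_lt_natFrac_add]
  rw [natFrac_eq_ofReal, ENNReal.ofReal_lt_ofReal_iff_of_nonneg (h0 x)]
  constructor
  · rintro ⟨n, hn⟩
    have := (abs_le.1 (h x n)).2
    rw [sub_div] at this
    push_cast at hn
    linarith
  · intro hx
    -- Half the gap suffices: one error for the approximation, one for the safety margin in the
    -- test.
    obtain ⟨n, hn⟩ := exists_nat_one_div_lt (show 0 < ((p.1 : ℝ) / (p.2 + 1) - f x) / 2 by linarith)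
    refine ⟨n, ?_⟩
    have := (abs_le.1 (h x n)).1
    rw [sub_div] at this
    push_cast
    linarith

theorem ComputableRealFun.lowerSemicomputable {f : β → ℝ} (hf : ComputableRealFun f) :
    LowerSemicomputable fun x => ENNReal.ofReal (f x) := by
  obtain ⟨g, hg, h⟩ := hf
  have hg' : Computable fun z : (β × (ℕ × ℕ)) × ℕ => g (z.1.1, z.2) :=
    hg.comp ((Computable.fst.comp Computable.fst).pair Computable.snd)
  refine (ComputablePred.exists_nat (computablePred_natFrac_add_lt
    (p := fun z : (β × (ℕ × ℕ)) × ℕ => ((g (z.1.1, z.2)).2 + 1, z.2)) (q := fun z => z.1.2)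
    (r := fun z => ((g (z.1.1, z.2)).1, z.2)) (s := fun _ => (0, 0))
    ((Computable.succ.comp (Computable.snd.comp hg')).pair Computable.snd)
    (Computable.snd.comp Computable.fst)
    ((Computable.fst.comp hg').pair Computable.snd) (Computable.const _))).of_eq ?_
  rintro ⟨x, p⟩
  simp only [natFrac_add_lt_natFrac_add]
  change _ ↔ natFrac p < ENNReal.ofReal (f x)
  rw [natFrac_eq_ofReal, ENNReal.ofReal_lt_ofReal_iff_of_nonneg (by positivity)]
  constructor
  · rintro ⟨n, hn⟩
    have := (abs_le.1 (h x n)).1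
    rw [sub_div] at this
    push_cast at hn
    rw [add_div] at hn
    simp only [zero_div] at hn
    linarith
  · intro hx
    obtain ⟨n, hn⟩ := exists_nat_one_div_lt (show 0 < (f x - (p.1 : ℝ) / (p.2 + 1)) / 2 by linarith)
    refine ⟨n, ?_⟩
    have := (abs_le.1 (h x n)).2
    rw [sub_div] at this
    push_cast
    rw [add_div]
    simp only [zero_div]
    linarith

/-- The reciprocal of a nonnegative computable function, with value zero at its zeros, is lower
semicomputable. -/
theorem ComputableRealFun.lowerSemicomputable_inv {f : β → ℝ} (hf : ComputableRealFun f)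
    (h0 : ∀ x, 0 ≤ f x) : LowerSemicomputable fun x => ENNReal.ofReal (f x)⁻¹ := by
  have hup := hf.re_lt_natFrac h0
  -- An upper bound `(a + 1)/(b + 1)` of `f x > 0` certifies the lower bound `(b + 1)/(a + 1)` of
  -- the reciprocal. The numerator is shifted to stay positive; at zeros of `f` there are no
  -- certificates, matching the value zero.
  refine LowerSemicomputable.of_certificates
    (S := fun x (w : ℕ × ℕ) => 0 < ENNReal.ofReal (f x) ∧
      ENNReal.ofReal (f x) < natFrac (w.1 + 1, w.2)) (v := fun w => (w.2 + 1, w.1))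
    ((hf.lowerSemicomputable.re_pos.comp Computable.fst).and
      (hup.comp (f := fun z : β × (ℕ × ℕ) => (z.1, (z.2.1 + 1, z.2.2)))
        (Computable.fst.pair ((Computable.succ.comp (Computable.fst.comp Computable.snd)).pair
          (Computable.snd.comp Computable.snd)))))
    ((Computable.succ.comp Computable.snd).pair Computable.fst) ?_ ?_
  · rintro x w ⟨h1, h2⟩
    rw [ENNReal.ofReal_pos] at h1
    rw [natFrac_eq_ofReal, ENNReal.ofReal_lt_ofReal_iff_of_nonneg h1.le] at h2
    rw [natFrac_eq_ofReal]
    refine ENNReal.ofReal_le_ofReal ?_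
    rw [le_inv_comm₀ (by positivity) h1, inv_div]
    push_cast at h2 ⊢
    exact h2.le
  · intro x c hc
    have hx : 0 < f x := by
      by_contra hx
      have : f x = 0 := le_antisymm (not_lt.1 hx) (h0 x)
      simp [this] at hc
    rw [ENNReal.ofReal_inv_of_pos hx, ENNReal.lt_inv_iff_lt_inv] at hc
    obtain ⟨⟨a, b⟩, h1, h2⟩ := exists_natFrac_btwn hc
    have ha : a ≠ 0 := by
      rintro rfl
      simp at h1
    obtain ⟨a, rfl⟩ := Nat.exists_eq_succ_of_ne_zero ha
    refine ⟨(a, b), ⟨ENNReal.ofReal_pos.2 hx, h1⟩, ?_⟩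
    rw [ENNReal.lt_inv_iff_lt_inv] at h2
    convert h2 using 1
    simp only [natFrac_eq_ofReal]
    rw [← ENNReal.ofReal_inv_of_pos (by positivity), inv_div]
    push_cast
    rfl

/-- It is recursively enumerable that a computable function is below a lower semicomputable one. -/
theorem ComputableRealFun.re_lt {f : β → ℝ} (hf : ComputableRealFun f) (h0 : ∀ x, 0 ≤ f x)
    {g : β → ℝ≥0∞} (hg : LowerSemicomputable g) :
    REPred fun x => ENNReal.ofReal (f x) < g x := by
  refine (REPred.exists (p := fun x p => ENNReal.ofReal (f x) < natFrac p ∧ natFrac p < g x)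
    ((hf.re_lt_natFrac h0).and (lowerSemicomputable_iff.1 hg))).of_eq fun x => ?_
  constructor
  · rintro ⟨p, h1, h2⟩
    exact h1.trans h2
  · exact exists_natFrac_btwn

theorem ComputableRealFun.comp {γ : Type*} [Primcodable γ] {f : γ → ℝ} (hf : ComputableRealFun f)
    {k : β → γ} (hk : Computable k) : ComputableRealFun fun x => f (k x) := by
  obtain ⟨g, hg, h⟩ := hf
  exact ⟨fun z => g (k z.1, z.2), hg.comp ((hk.comp Computable.fst).pair Computable.snd),
    fun x n => h (k x) n⟩

end ComputableRealFun

/-! ## String probabilities and code ratios -/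

section StringProb

theorem seqPrefix_length {α : Type*} (x : ℕ → α) (n : ℕ) : (seqPrefix x n).length = n := by
  simp [seqPrefix]

@[simp] theorem seqPrefix_zero {α : Type*} (x : ℕ → α) : seqPrefix x 0 = [] := rfl

theorem seqPrefix_succ {α : Type*} (x : ℕ → α) (n : ℕ) :
    seqPrefix x (n + 1) = seqPrefix x n ++ [x n] := by
  rw [seqPrefix, List.ofFn_succ_last]
  rfl

theorem exp_neg_logCode {α : Type*} (w : List α → ℝ≥0∞) (xs : List α) :
    EReal.exp (-logCode w xs) = w xs := by
  simp [logCode]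

variable {α : Type*} [MeasurableSpace α] {P₀ : Measure (ℕ → α)}

theorem hasLaw_coordinates (P₀ : Measure (ℕ → α)) : HasLaw (fun (x : ℕ → α) i => x i) P₀ P₀ :=
  ⟨aemeasurable_id, Measure.map_id⟩

theorem codeRatio_logCode (w : List α → ℝ≥0∞) (xs : List α) :
    codeRatio (logCode w) P₀ xs = (w xs).toReal / (stringProb P₀ xs).toReal := by
  rw [codeRatio, exp_neg_logCode]

theorem codeRatio_nonneg (ℓ : List α → EReal) (xs : List α) : 0 ≤ codeRatio ℓ P₀ xs :=
  div_nonneg ENNReal.toReal_nonneg ENNReal.toReal_nonneg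

variable [IsProbabilityMeasure P₀]

@[simp] theorem stringProb_nil : stringProb P₀ [] = 1 := by
  simp [stringProb]

theorem stringProb_ne_top (y : List α) : stringProb P₀ y ≠ ∞ := measure_ne_top _ _

theorem ofReal_codeRatio_mul {w : List α → ℝ≥0∞} {xs : List α} (hw : w xs ≠ ∞)
    (h : stringProb P₀ xs ≠ 0) :
    ENNReal.ofReal (codeRatio (logCode w) P₀ xs) * stringProb P₀ xs = w xs := by
  have h' := stringProb_ne_top (P₀ := P₀) xs
  rw [codeRatio_logCode, ← ENNReal.toReal_div, ENNReal.ofReal_toReal (ENNReal.div_ne_top hw h),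
    ENNReal.div_mul_cancel h h']

theorem ofReal_codeRatio_mul_le {w : List α → ℝ≥0∞} {xs : List α} (hw : w xs ≠ ∞) :
    ENNReal.ofReal (codeRatio (logCode w) P₀ xs) * stringProb P₀ xs ≤ w xs := by
  by_cases h : stringProb P₀ xs = 0
  · simp [h]
  · exact (ofReal_codeRatio_mul hw h).le

end StringProb

/-! ## Prefixes of random sequences -/

section Prefix

/-- A sum over strings is a sum over the empty string and the extensions of strings by a symbol. -/
theorem tsum_list_append {α : Type*} (G : List α → ℝ≥0∞) (h : G [] = 0) :
    ∑' y, G y = ∑' xs, ∑' a, G (xs ++ [a]) := by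
  have hinj : Function.Injective fun z : List α × α => z.1 ++ [z.2] := by
    rintro ⟨x, a⟩ ⟨y, b⟩ hxy
    have := List.append_inj' hxy rfl
    simpa using this
  rw [← ENNReal.tsum_prod (f := fun xs a => G (xs ++ [a]))]
  refine (hinj.tsum_eq fun y hy => ?_).symm
  have hy' : y ≠ [] := by
    rintro rfl
    exact hy h
  exact ⟨(y.dropLast, y.getLast hy'), List.dropLast_append_getLast hy'⟩

variable {Ω α : Type*} [MeasurableSpace Ω] [Countable α] [MeasurableSpace α]
  [MeasurableSingletonClass α] {P : Measure Ω} {X : ℕ → Ω → α} {P₀ : Measure (ℕ → α)}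

theorem measurable_seqPrefix (hX : ∀ i, Measurable (X i)) (t : ℕ) :
    Measurable[_, ⊤] fun ω => seqPrefix (fun i => X i ω) t := by
  let _ : MeasurableSpace (List α) := ⊤
  have h1 : Measurable fun (v : Fin t → α) => List.ofFn v := measurable_of_countable _
  exact h1.comp (measurable_pi_lambda (fun ω (i : Fin t) => X i ω) fun i => hX i)

theorem measurableSet_seqPrefix_mem (hX : ∀ i, Measurable (X i)) (t : ℕ) (B : Set (List α)) :
    MeasurableSet {ω | seqPrefix (fun i => X i ω) t ∈ B} :=
  measurable_seqPrefix hX t (MeasurableSpace.measurableSet_top (s := B))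

theorem measurableSet_seqPrefix_eq (t : ℕ) (y : List α) :
    MeasurableSet {x : ℕ → α | seqPrefix x t = y} :=
  measurableSet_seqPrefix_mem (X := fun i (x : ℕ → α) => x i) (fun i => measurable_pi_apply i) t {y}

theorem measure_seqPrefix_eq (hlaw : HasLaw (fun ω i => X i ω) P₀ P) (t : ℕ) (y : List α) :
    P {ω | seqPrefix (fun i => X i ω) t = y} = if y.length = t then stringProb P₀ y else 0 := by
  split_ifs with h
  · subst h
    exact hlaw.measure_eq (p := fun x => seqPrefix x y.length = y) (measurableSet_seqPrefix_eq _ _)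
  · convert measure_empty (μ := P)
    ext ω
    simp only [Set.mem_ofPred_eq, Set.mem_empty_iff_false, iff_false]
    rintro rfl
    exact h (seqPrefix_length _ _)

theorem lintegral_seqPrefix (hX : ∀ i, Measurable (X i)) (hlaw : HasLaw (fun ω i => X i ω) P₀ P)
    (t : ℕ) (F : List α → ℝ≥0∞) :
    ∫⁻ ω, F (seqPrefix (fun i => X i ω) t) ∂P =
      ∑' y, if y.length = t then F y * stringProb P₀ y else 0 := by
  let _ : MeasurableSpace (List α) := ⊤
  have _ : MeasurableSingletonClass (List α) := ⟨fun _ => MeasurableSpace.measurableSet_top⟩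
  have hm := measurable_seqPrefix hX t
  have hF : Measurable F := fun _ _ => MeasurableSpace.measurableSet_top
  rw [← lintegral_map hF hm, lintegral_countable']
  refine tsum_congr fun y => ?_
  rw [Measure.map_apply hm (measurableSet_singleton y)]
  change F y * P {ω | seqPrefix (fun i => X i ω) t = y} = _
  rw [measure_seqPrefix_eq hlaw, mul_ite, mul_zero]

theorem setLIntegral_seqPrefix (hX : ∀ i, Measurable (X i))
    (hlaw : HasLaw (fun ω i => X i ω) P₀ P) (t : ℕ) (B : Set (List α)) (F : List α → ℝ≥0∞) :
    ∫⁻ ω in {ω | seqPrefix (fun i => X i ω) t ∈ B}, F (seqPrefix (fun i => X i ω) t) ∂P =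
      ∑' y, if y.length = t then B.indicator F y * stringProb P₀ y else 0 := by
  rw [← lintegral_seqPrefix hX hlaw, ← lintegral_indicator (measurableSet_seqPrefix_mem hX t B)]
  rfl

/-- The event is read off the longer prefix by dropping its last symbol; then each string of length
`t + 1` is split into its past and that symbol. -/
theorem setLIntegral_seqPrefix_succ (hX : ∀ i, Measurable (X i))
    (hlaw : HasLaw (fun ω i => X i ω) P₀ P) (t : ℕ) (B : Set (List α)) (F : List α → ℝ≥0∞) :
    ∫⁻ ω in {ω | seqPrefix (fun i => X i ω) t ∈ B}, F (seqPrefix (fun i => X i ω) (t + 1)) ∂P =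
      ∑' y, if y.length = t then
        B.indicator (fun y => ∑' a, F (y ++ [a]) * stringProb P₀ (y ++ [a])) y else 0 := by
  have hset : {ω | seqPrefix (fun i => X i ω) t ∈ B} =
      {ω | seqPrefix (fun i => X i ω) (t + 1) ∈ {y | y.dropLast ∈ B}} := by
    ext ω
    simp [seqPrefix_succ]
  rw [hset, setLIntegral_seqPrefix hX hlaw, tsum_list_append _ (by simp)]
  refine tsum_congr fun y => ?_
  by_cases hy : y.length = t <;> by_cases hB : y ∈ B <;> simp [hy, hB, Set.indicator]

theorem tsum_stringProb_append (xs : List α) :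
    ∑' a, stringProb P₀ (xs ++ [a]) = stringProb P₀ xs := by
  have hX : ∀ i, Measurable fun x : ℕ → α => x i := fun i => measurable_pi_apply i
  have h1 := setLIntegral_seqPrefix hX (hasLaw_coordinates P₀) xs.length {xs} fun _ => 1
  have h2 := setLIntegral_seqPrefix_succ hX (hasLaw_coordinates P₀) xs.length {xs}
    fun _ => 1
  rw [h1] at h2
  rw [tsum_eq_single xs (by intro y hy; simp [hy]), tsum_eq_single xs (by intro y hy; simp [hy])]
    at h2
  simpa using h2.symm

theorem stringProb_append_le (xs : List α) (a : α) :
    stringProb P₀ (xs ++ [a]) ≤ stringProb P₀ xs :=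
  (ENNReal.le_tsum a).trans (tsum_stringProb_append xs).le

variable [IsProbabilityMeasure P₀]

theorem isSemimeasure_stringProb : IsSemimeasure (stringProb P₀) :=
  ⟨stringProb_nil.le, fun xs => (tsum_stringProb_append xs).le⟩

theorem tsum_stringProb_length (n : ℕ) :
    ∑' y : List α, (if y.length = n then stringProb P₀ y else 0) = 1 := by
  have := lintegral_seqPrefix (fun i => measurable_pi_apply i) (hasLaw_coordinates P₀) n
    fun _ => 1
  simpa using this.symm

end Prefix

/-! ## The E-process of a semimeasure -/

section CodeToE

variable {Ω α : Type*} [MeasurableSpace Ω] [Countable α] [MeasurableSpace α]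
  [MeasurableSingletonClass α] {P : Measure Ω} {X : ℕ → Ω → α} {P₀ : Measure (ℕ → α)}

theorem IsSemimeasure.le_one {α : Type*} {w : List α → ℝ≥0∞} (hw : IsSemimeasure w)
    (xs : List α) : w xs ≤ 1 := by
  induction xs using List.reverseRecOn with
  | nil => exact hw.1
  | append_singleton xs a ih => exact (ENNReal.le_tsum a).trans ((hw.2 xs).trans ih)

/-- Over a countable alphabet every set of strings of length `t` is measurable, so conditional
statements reduce to sums over strings. -/
theorem measurableSet_dataFiltration_iff (hX : ∀ i, Measurable (X i)) {t : ℕ} {s : Set Ω} :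
    MeasurableSet[dataFiltration X hX t] s ↔
      ∃ B : Set (List α), {ω | seqPrefix (fun i => X i ω) t ∈ B} = s := by
  constructor
  · rintro ⟨B, -, rfl⟩
    refine ⟨List.ofFn '' B, ?_⟩
    ext ω
    simp [seqPrefix, List.ofFn_injective.eq_iff]
  · rintro ⟨B, rfl⟩
    exact ⟨List.ofFn ⁻¹' B, (Set.to_countable _).measurableSet, rfl⟩

theorem stronglyAdapted_codeProcess (hX : ∀ i, Measurable (X i)) (ℓ : List α → EReal) :
    StronglyAdapted (dataFiltration X hX) (codeProcess ℓ P₀ X) := by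
  intro t
  refine Measurable.stronglyMeasurable ?_
  intro s _
  exact (measurableSet_dataFiltration_iff hX).2 ⟨codeRatio ℓ P₀ ⁻¹' s, rfl⟩

variable [IsProbabilityMeasure P₀]

/-- The supermartingale inequality, string by string: the null probability cancels and the
semimeasure inequality for `w` remains. -/
theorem setLIntegral_codeProcess_succ_le (hX : ∀ i, Measurable (X i))
    (hlaw : HasLaw (fun ω i => X i ω) P₀ P) {w : List α → ℝ≥0∞} (hw : IsSemimeasure w) (t : ℕ)
    (B : Set (List α)) :
    ∫⁻ ω in {ω | seqPrefix (fun i => X i ω) t ∈ B},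
        ENNReal.ofReal (codeProcess (logCode w) P₀ X (t + 1) ω) ∂P ≤
      ∫⁻ ω in {ω | seqPrefix (fun i => X i ω) t ∈ B},
        ENNReal.ofReal (codeProcess (logCode w) P₀ X t ω) ∂P := by
  have hfin : ∀ y, w y ≠ ∞ := fun y => ne_top_of_le_ne_top ENNReal.one_ne_top (hw.le_one y)
  refine (setLIntegral_seqPrefix_succ hX hlaw t B fun y =>
    ENNReal.ofReal (codeRatio (logCode w) P₀ y)).trans_le (le_trans ?_ (setLIntegral_seqPrefix hX
      hlaw t B fun y => ENNReal.ofReal (codeRatio (logCode w) P₀ y)).ge)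
  refine ENNReal.tsum_le_tsum fun y => ?_
  split_ifs with hy
  swap; · exact le_rfl
  by_cases hB : y ∈ B
  swap; · simp [hB]
  rw [Set.indicator_of_mem hB, Set.indicator_of_mem hB]
  -- Extensions of a null string are null, so both sides vanish there.
  by_cases h0 : stringProb P₀ y = 0
  · have : ∀ a, stringProb P₀ (y ++ [a]) = 0 := fun a =>
      le_antisymm ((stringProb_append_le y a).trans h0.le) zero_le
    simp [this]
  · rw [ofReal_codeRatio_mul (hfin y) h0]
    exact (ENNReal.tsum_le_tsum fun a => ofReal_codeRatio_mul_le (hfin _)).trans (hw.2 y)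

theorem lintegral_codeProcess_le_one [IsProbabilityMeasure P] (hX : ∀ i, Measurable (X i))
    (hlaw : HasLaw (fun ω i => X i ω) P₀ P) {w : List α → ℝ≥0∞} (hw : IsSemimeasure w) (t : ℕ) :
    ∫⁻ ω, ENNReal.ofReal (codeProcess (logCode w) P₀ X t ω) ∂P ≤ 1 := by
  induction t with
  | zero =>
    have h0 : ∀ ω, codeProcess (logCode w) P₀ X 0 ω = (w []).toReal := by
      intro ω
      simp [codeProcess, codeRatio_logCode]
    simp only [h0, lintegral_const, measure_univ, mul_one]
    exact ENNReal.ofReal_toReal_le.trans hw.1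
  | succ t ih =>
    have := setLIntegral_codeProcess_succ_le hX hlaw hw t Set.univ
    simp only [Set.mem_univ, Set.ofPred_true, Measure.restrict_univ] at this
    exact this.trans ih

theorem isEProcess_codeProcess [IsProbabilityMeasure P] (hX : ∀ i, Measurable (X i))
    (hlaw : HasLaw (fun ω i => X i ω) P₀ P) {w : List α → ℝ≥0∞} (hw : IsSemimeasure w) :
    IsEProcess (codeProcess (logCode w) P₀ X) (dataFiltration X hX) P := by
  have hnn : ∀ t ω, 0 ≤ codeProcess (logCode w) P₀ X t ω := fun t ω => codeRatio_nonneg _ _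
  have hadp := stronglyAdapted_codeProcess (P₀ := P₀) hX (logCode w)
  have hmeas : ∀ t, AEStronglyMeasurable (codeProcess (logCode w) P₀ X t) P := fun t =>
    ((hadp t).mono ((dataFiltration X hX).le t)).aestronglyMeasurable
  have hint : ∀ t, Integrable (codeProcess (logCode w) P₀ X t) P := fun t => by
    refine ⟨hmeas t, ?_⟩
    rw [hasFiniteIntegral_iff_ofReal (ae_of_all _ (hnn t))]
    exact (lintegral_codeProcess_le_one hX hlaw hw t).trans_lt ENNReal.one_lt_top
  refine ⟨hnn, supermartingale_of_setIntegral_succ_le hadp hint fun t s hs => ?_, ?_⟩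
  · obtain ⟨B, rfl⟩ := (measurableSet_dataFiltration_iff hX).1 hs
    rw [integral_eq_lintegral_of_nonneg_ae (ae_of_all _ (hnn _)) (hmeas _).restrict,
      integral_eq_lintegral_of_nonneg_ae (ae_of_all _ (hnn _)) (hmeas _).restrict]
    refine ENNReal.toReal_mono ?_ (setLIntegral_codeProcess_succ_le hX hlaw hw t B)
    exact ((setLIntegral_le_lintegral _ _).trans_lt ((lintegral_codeProcess_le_one hX hlaw hw
      t).trans_lt ENNReal.one_lt_top)).ne
  · rw [integral_eq_lintegral_of_nonneg_ae (ae_of_all _ (hnn _)) (hmeas _)]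
    exact ENNReal.toReal_le_of_le_ofReal zero_le_one
      (by simpa using lintegral_codeProcess_le_one hX hlaw hw 0)

/-- Under a null of full support, the supermartingale property forces the semimeasure inequality of
the string weight. -/
theorem tsum_append_le_of_supermartingale [IsProbabilityMeasure P] (hX : ∀ i, Measurable (X i))
    (hlaw : HasLaw (fun ω i => X i ω) P₀ P) (hpos : ∀ xs, 0 < stringProb P₀ xs)
    {w : List α → ℝ≥0∞} {xs : List α} (hw : w xs ≠ ∞) (hw' : ∀ a, w (xs ++ [a]) ≠ ∞)
    (hE : Supermartingale (codeProcess (logCode w) P₀ X) (dataFiltration X hX) P) :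
    ∑' a, w (xs ++ [a]) ≤ w xs := by
  have hnn : ∀ t ω, 0 ≤ codeProcess (logCode w) P₀ X t ω := fun t ω => codeRatio_nonneg _ _
  set s : Set Ω := {ω | seqPrefix (fun i => X i ω) xs.length ∈ ({xs} : Set (List α))} with hs
  have h := hE.setIntegral_le (Nat.le_succ xs.length)
    ((measurableSet_dataFiltration_iff hX).2 ⟨{xs}, hs.symm⟩)
  have h' := ENNReal.ofReal_le_ofReal h
  rw [ofReal_integral_eq_lintegral_ofReal (hE.integrable _).integrableOn (ae_of_all _ (hnn _)),
    ofReal_integral_eq_lintegral_ofReal (hE.integrable _).integrableOn (ae_of_all _ (hnn _))] at h'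
  have h1 := setLIntegral_seqPrefix_succ hX hlaw xs.length {xs} fun y =>
    ENNReal.ofReal (codeRatio (logCode w) P₀ y)
  have h2 := setLIntegral_seqPrefix hX hlaw xs.length {xs} fun y =>
    ENNReal.ofReal (codeRatio (logCode w) P₀ y)
  rw [tsum_eq_single xs (by intro y hy; simp [hy])] at h1 h2
  -- Full support makes the cancellation exact at `xs` and at every extension, so no mass of `w` is
  -- lost to the zero convention.
  simp only [if_true, Set.indicator_of_mem (Set.mem_singleton xs),
    ofReal_codeRatio_mul hw (hpos _).ne',
    ofReal_codeRatio_mul (hw' _) (hpos _).ne'] at h1 h2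
  exact (h1.symm.trans_le h').trans h2.le

end CodeToE

/-! ## The NML code of the Bernoulli model -/

section NML

/-- The likelihood of a binary string under the Bernoulli model with parameter `θ`. -/
def bernoulliLikelihood (θ : ℝ) (y : List Bool) : ℝ :=
  (y.map fun b => if b then θ else 1 - θ).prod

instance (θ : unitInterval) : IsProbabilityMeasure (bernoulliSeq θ) := by
  unfold bernoulliSeq
  infer_instance

theorem bernoulliMeasure_singleton (θ : unitInterval) (b : Bool) :
    bernoulliMeasure true false θ {b} = ENNReal.ofReal (if b then (θ : ℝ) else 1 - θ) := by
  cases b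
  · rw [bernoulliMeasure_apply_of_notMem_of_mem θ (measurableSet_singleton _) (by simp) (by simp)]
    rw [ENNReal.ofReal, ENNReal.coe_inj]
    exact NNReal.eq (by simp [θ.2.2])
  · rw [bernoulliMeasure_apply_of_mem_of_notMem θ (measurableSet_singleton _) (by simp) (by simp)]
    rw [ENNReal.ofReal, ENNReal.coe_inj]
    exact NNReal.eq (by simp [θ.2.1])

theorem prod_range_getD {M : Type*} [CommMonoid M] {α : Type*} (d : α) (f : α → M) (y : List α) :
    ∏ i ∈ Finset.range y.length, f (y.getD i d) = (y.map f).prod := by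
  induction y with
  | nil => simp
  | cons a y ih => simp [Finset.prod_range_succ', ← ih, mul_comm]

theorem stringProb_bernoulliSeq (θ : unitInterval) (y : List Bool) :
    stringProb (bernoulliSeq θ) y = ENNReal.ofReal (bernoulliLikelihood θ y) := by
  -- The cylinder is a box with finitely many constrained coordinates; the default `false` is never
  -- reached.
  have hset : {x : ℕ → Bool | seqPrefix x y.length = y} =
      Set.pi (Finset.range y.length) fun i => {y.getD i false} := by
    ext x
    simp only [Set.mem_ofPred_eq, Set.mem_pi, Finset.coe_range, Set.mem_Iio,
      Set.mem_singleton_iff]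
    constructor
    · intro h i hi
      conv_rhs => rw [← h]
      simp [seqPrefix, hi]
    · intro h
      refine List.ext_getElem (seqPrefix_length _ _) fun i _ hi => ?_
      simpa [seqPrefix, hi] using h i hi
  rw [stringProb, hset, bernoulliSeq, Measure.infinitePi_pi _ fun i _ => measurableSet_singleton _,
    prod_range_getD false (fun b => bernoulliMeasure true false θ {b})]
  clear hset
  simp only [bernoulliMeasure_singleton]
  induction y with
  | nil => simp [bernoulliLikelihood]
  | cons b y ih =>
    rw [List.map_cons, List.prod_cons, ih, bernoulliLikelihood, bernoulliLikelihood, List.map_cons,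
      List.prod_cons, ENNReal.ofReal_mul]
    cases b <;> simp [θ.2.1, θ.2.2]

theorem maxLikelihood_bernoulliSeq {y : List Bool} {c : ℝ}
    (hle : ∀ θ : ℝ, 0 ≤ θ → θ ≤ 1 → bernoulliLikelihood θ y ≤ c) {θ₀ : ℝ} (h0 : 0 ≤ θ₀)
    (h1 : θ₀ ≤ 1) (heq : bernoulliLikelihood θ₀ y = c) :
    maxLikelihood bernoulliSeq y = ENNReal.ofReal c := by
  refine le_antisymm (iSup_le fun θ => ?_) (le_iSup_of_le ⟨θ₀, h0, h1⟩ ?_)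
  · rw [stringProb_bernoulliSeq]
    exact ENNReal.ofReal_le_ofReal (hle θ θ.2.1 θ.2.2)
  · rw [stringProb_bernoulliSeq, heq]

theorem tsum_ofFn_bool_succ (n : ℕ) (F : List Bool → ℝ≥0∞) :
    ∑' v : Fin (n + 1) → Bool, F (List.ofFn v) =
      ∑' v : Fin n → Bool, F (true :: List.ofFn v) +
        ∑' v : Fin n → Bool, F (false :: List.ofFn v) := by
  rw [← (Fin.consEquiv fun _ => Bool).tsum_eq, ENNReal.tsum_prod', tsum_bool, add_comm]
  simp [Fin.consEquiv, List.ofFn_succ]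

theorem tsum_ofFn_bool_two (F : List Bool → ℝ≥0∞) :
    ∑' v : Fin 2 → Bool, F (List.ofFn v) =
      F [true, true] + F [true, false] + (F [false, true] + F [false, false]) := by
  rw [tsum_ofFn_bool_succ, tsum_ofFn_bool_succ 0 fun l => F (true :: l),
    tsum_ofFn_bool_succ 0 fun l => F (false :: l)]
  simp [tsum_fintype]

/-- The maximum is at `θ = 2/3`: `4/27 - θ²(1 - θ) = (θ - 2/3)²(θ + 1/3)`. -/
theorem mul_mul_one_sub_le {θ : ℝ} (h0 : 0 ≤ θ) : θ * (θ * (1 - θ)) ≤ 4 / 27 := by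
  nlinarith [mul_nonneg (sq_nonneg (θ - 2 / 3)) (show 0 ≤ θ + 1 / 3 by linarith)]

theorem mul_mul_self_le_one {θ : ℝ} (h0 : 0 ≤ θ) (h1 : θ ≤ 1) : θ * (θ * θ) ≤ 1 :=
  mul_le_one₀ h1 (mul_nonneg h0 h0) (mul_le_one₀ h1 h0 h1)

theorem maxLikelihood_bernoulliSeq_two (a b : Bool) :
    maxLikelihood bernoulliSeq [a, b] = ENNReal.ofReal (if a = b then 1 else 1 / 4) := by
  have hsq : ∀ θ : ℝ, θ * (1 - θ) ≤ 1 / 4 := fun θ => by nlinarith [sq_nonneg (θ - 1 / 2)]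
  cases a <;> cases b <;> simp only [if_true, reduceIte, Bool.false_eq_true, Bool.true_eq_false]
  case' false.false =>
    refine maxLikelihood_bernoulliSeq (θ₀ := 0) (fun θ h0 h1 => ?_) (by norm_num) (by norm_num) ?_
  case' true.true =>
    refine maxLikelihood_bernoulliSeq (θ₀ := 1) (fun θ h0 h1 => ?_) (by norm_num) (by norm_num) ?_
  case' false.true | true.false =>
    refine maxLikelihood_bernoulliSeq (θ₀ := 1 / 2) (fun θ h0 h1 => ?_) (by norm_num)
      (by norm_num) ?_
  all_goals
    simp only [bernoulliLikelihood, List.map_cons, List.map_nil, List.prod_cons, List.prod_nil,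
      reduceIte, Bool.false_eq_true, mul_one]
  all_goals
    first
    | norm_num; done
    | linarith [hsq θ]
    | exact mul_le_one₀ (by linarith) (by linarith) (by linarith)

theorem maxLikelihood_bernoulliSeq_three (a b c : Bool) :
    maxLikelihood bernoulliSeq [a, b, c] =
      ENNReal.ofReal (if a = b ∧ b = c then 1 else 4 / 27) := by
  cases a <;> cases b <;> cases c <;>
    simp only [reduceIte, Bool.false_eq_true, Bool.true_eq_false, and_self, and_true, and_false]
  -- In each case `θ₀` is the empirical frequency of `true`, the maximum likelihood estimate.
  case' false.false.false =>
    refine maxLikelihood_bernoulliSeq (θ₀ := 0) (fun θ h0 h1 => ?_) (by norm_num) (by norm_num) ?_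
  case' true.true.true =>
    refine maxLikelihood_bernoulliSeq (θ₀ := 1) (fun θ h0 h1 => ?_) (by norm_num) (by norm_num) ?_
  case' true.true.false | true.false.true | false.true.true =>
    refine maxLikelihood_bernoulliSeq (θ₀ := 2 / 3) (fun θ h0 h1 => ?_) (by norm_num)
      (by norm_num) ?_
  case' false.false.true | false.true.false | true.false.false =>
    refine maxLikelihood_bernoulliSeq (θ₀ := 1 / 3) (fun θ h0 h1 => ?_) (by norm_num)
      (by norm_num) ?_
  all_goals
    simp only [bernoulliLikelihood, List.map_cons, List.map_nil, List.prod_cons, List.prod_nil,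
      reduceIte, Bool.false_eq_true, mul_one]
  all_goals
    first
    | norm_num; done
    | exact mul_mul_self_le_one (by linarith) (by linarith)
    | linarith [mul_mul_one_sub_le h0]
    | linarith [mul_mul_one_sub_le (sub_nonneg.2 h1)]

theorem nmlNormalizer_bernoulliSeq_two : nmlNormalizer bernoulliSeq 2 = ENNReal.ofReal (5 / 2) := by
  rw [nmlNormalizer, tsum_ofFn_bool_two]
  simp only [maxLikelihood_bernoulliSeq_two, reduceIte, Bool.false_eq_true, Bool.true_eq_false]
  rw [← ENNReal.ofReal_add (by norm_num) (by norm_num),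
    ← ENNReal.ofReal_add (by norm_num) (by norm_num),
    ← ENNReal.ofReal_add (by norm_num) (by norm_num)]
  norm_num

theorem nmlNormalizer_bernoulliSeq_three :
    nmlNormalizer bernoulliSeq 3 = ENNReal.ofReal (26 / 9) := by
  rw [nmlNormalizer, tsum_ofFn_bool_succ,
    tsum_ofFn_bool_two fun l => maxLikelihood bernoulliSeq (true :: l),
    tsum_ofFn_bool_two fun l => maxLikelihood bernoulliSeq (false :: l)]
  simp only [maxLikelihood_bernoulliSeq_three, reduceIte, Bool.false_eq_true, Bool.true_eq_false,
    and_self, and_true, and_false]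
  repeat rw [← ENNReal.ofReal_add (by norm_num) (by norm_num)]
  norm_num

theorem nml_bernoulliSeq_two (a b : Bool) : nml bernoulliSeq [a, b] =
    ENNReal.ofReal ((if a = b then 1 else 1 / 4) / (5 / 2)) := by
  rw [ENNReal.ofReal_div_of_pos (by norm_num), ← maxLikelihood_bernoulliSeq_two,
    ← nmlNormalizer_bernoulliSeq_two]
  rfl

theorem nml_bernoulliSeq_three (a b c : Bool) : nml bernoulliSeq [a, b, c] =
    ENNReal.ofReal ((if a = b ∧ b = c then 1 else 4 / 27) / (26 / 9)) := by
  rw [ENNReal.ofReal_div_of_pos (by norm_num), ← maxLikelihood_bernoulliSeq_three,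
    ← nmlNormalizer_bernoulliSeq_three]
  rfl

/-- The NML distributions of the Bernoulli model are not consistent: at sample size three the
extensions of the string `10` have more mass than the string at sample size two. -/
theorem nml_bernoulliSeq_lt_tsum_append :
    nml bernoulliSeq [true, false] < ∑' a, nml bernoulliSeq ([true, false] ++ [a]) := by
  simp only [tsum_bool, List.cons_append, List.nil_append, nml_bernoulliSeq_two,
    nml_bernoulliSeq_three]
  rw [← ENNReal.ofReal_add (by split_ifs <;> norm_num) (by split_ifs <;> norm_num)]
  -- The comparison is `(1/4)/(5/2) = 1/10 < 4/39 = 2 · (4/27)/(26/9)`.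
  refine (ENNReal.ofReal_lt_ofReal_iff_of_nonneg (by norm_num)).2 ?_
  norm_num

theorem nmlNormalizer_bernoulliSeq_two_ne_three :
    nmlNormalizer bernoulliSeq 2 ≠ nmlNormalizer bernoulliSeq 3 := by
  rw [nmlNormalizer_bernoulliSeq_two, nmlNormalizer_bernoulliSeq_three]
  exact ((ENNReal.ofReal_lt_ofReal_iff_of_nonneg (by norm_num)).2 (by norm_num)).ne

theorem SequentiallyFactorizes.tsum_append_le {α : Type*} {w : List α → ℝ≥0∞}
    (h : SequentiallyFactorizes (logCode w)) (xs : List α) : ∑' a, w (xs ++ [a]) ≤ w xs := by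
  obtain ⟨q, hq, hw⟩ := h
  simp only [exp_neg_logCode] at hw
  simp only [hw, ENNReal.tsum_mul_left]
  exact mul_le_of_le_one_right zero_le (hq xs)

theorem not_sequentiallyFactorizes_nml_bernoulliSeq :
    ¬ SequentiallyFactorizes (logCode (nml bernoulliSeq)) := fun h =>
  absurd (h.tsum_append_le _) (not_le.2 nml_bernoulliSeq_lt_tsum_append)

theorem not_supermartingale_nml_bernoulliSeq {Ω : Type*} [MeasurableSpace Ω] {P : Measure Ω}
    [IsProbabilityMeasure P] {X : ℕ → Ω → Bool} (hX : ∀ i, Measurable (X i))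
    {P₀ : Measure (ℕ → Bool)} [IsProbabilityMeasure P₀] (hlaw : HasLaw (fun ω i => X i ω) P₀ P)
    (hpos : ∀ xs, 0 < stringProb P₀ xs) :
    ¬ Supermartingale (codeProcess (logCode (nml bernoulliSeq)) P₀ X) (dataFiltration X hX) P := by
  intro hE
  refine absurd (tsum_append_le_of_supermartingale hX hlaw hpos ?_ ?_ hE)
    (not_le.2 nml_bernoulliSeq_lt_tsum_append)
  · rw [nml_bernoulliSeq_two]
    exact ENNReal.ofReal_ne_top
  · intro a
    simp only [List.cons_append, List.nil_append, nml_bernoulliSeq_three]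
    exact ENNReal.ofReal_ne_top

instance : IsProbabilityMeasure fairCoin := by
  unfold fairCoin
  infer_instance

theorem stringProb_fairCoin_pos (y : List Bool) : 0 < stringProb fairCoin y := by
  rw [fairCoin, stringProb_bernoulliSeq, ENNReal.ofReal_pos, bernoulliLikelihood]
  refine List.prod_pos fun x hx => ?_
  obtain ⟨b, -, rfl⟩ := List.mem_map.1 hx
  cases b <;> norm_num

end NML

/-! ## Universal semimeasures -/

section Mixture

variable {α : Type*}

/-- The weight `2^{-(k+1)}`. -/
noncomputable def dyadicWeight (k : ℕ) : ℝ≥0∞ := natFrac (1, 2 ^ (k + 1) - 1)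

theorem dyadicWeight_eq (k : ℕ) : dyadicWeight k = 2⁻¹ ^ (k + 1) := by
  have h : (1 : ℕ) ≤ 2 ^ (k + 1) := Nat.one_le_two_pow
  have h' : (((2 ^ (k + 1) - 1 : ℕ) : ℝ≥0∞) + 1) = 2 ^ (k + 1) := by
    exact_mod_cast congrArg (Nat.cast (R := ℝ≥0∞)) (Nat.sub_add_cancel h)
  rw [dyadicWeight, natFrac, h']
  simp [ENNReal.inv_pow]

theorem dyadicWeight_ne_zero (k : ℕ) : dyadicWeight k ≠ 0 := by
  rw [dyadicWeight_eq]
  exact pow_ne_zero _ (by simp)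

theorem tsum_dyadicWeight : ∑' k, dyadicWeight k = 1 := by
  simp only [dyadicWeight_eq]
  rw [ENNReal.tsum_geometric_add_one, ENNReal.one_sub_inv_two, inv_inv]
  exact ENNReal.inv_mul_cancel (by simp) (by simp)

theorem lowerSemicomputable_dyadicWeight : LowerSemicomputable dyadicWeight := by
  have hpow : Primrec₂ ((· ^ ·) : ℕ → ℕ → ℕ) := Primrec₂.unpaired'.1 Nat.Primrec.pow
  exact Computable.lowerSemicomputable_natFrac ((Primrec.const 1).pair
    (Primrec.pred.comp (hpow.comp (Primrec.const 2) Primrec.succ))).to_comp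

/-- The mixture with dyadic weights of the point masses at the strings `z k`, as a function of the
prefixes of these strings. -/
noncomputable def prefixMixture (z : ℕ → List α) (y : List α) : ℝ≥0∞ :=
  ∑' k, {p : List α × ℕ | p.1 <+: z p.2}.indicator (fun p => dyadicWeight p.2) (y, k)

theorem dyadicWeight_le_prefixMixture (z : ℕ → List α) (k : ℕ) :
    dyadicWeight k ≤ prefixMixture z (z k) := by
  refine le_trans ?_ (ENNReal.le_tsum k)
  rw [Set.indicator_of_mem]
  exact List.prefix_rfl

/-- For each `k`, at most one symbol extends `xs` to a prefix of `z k`, and then `xs` is itself such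
a prefix; the weights sum to one. -/
theorem isSemimeasure_prefixMixture (z : ℕ → List α) : IsSemimeasure (prefixMixture z) := by
  refine ⟨(ENNReal.tsum_le_tsum fun k => Set.indicator_le_self _ _ _).trans
    tsum_dyadicWeight.le, fun xs => ?_⟩
  unfold prefixMixture
  rw [ENNReal.tsum_comm]
  refine ENNReal.tsum_le_tsum fun k => ?_
  by_cases h : ∃ a, xs ++ [a] <+: z k
  · obtain ⟨a, ha⟩ := h
    rw [tsum_eq_single a]
    · rw [Set.indicator_of_mem (by exact ha), Set.indicator_of_mem]
      exact (List.prefix_append _ _).trans ha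
    · intro b hb
      refine Set.indicator_of_notMem (fun hb' => hb ?_) _
      have := (List.prefix_of_prefix_length_le hb' ha (by simp)).eq_of_length (by simp)
      simpa using this
  · push Not at h
    rw [ENNReal.tsum_eq_zero.2 fun a => Set.indicator_of_notMem (by exact h a) _]
    exact zero_le

theorem lowerSemicomputable_prefixMixture [Primcodable α] {z : ℕ → List α} (hz : Computable z) :
    LowerSemicomputable (prefixMixture z) := by
  classical
  have h : REPred fun p : List α × ℕ => p.1 <+: z p.2 := by
    have h1 : REPred fun w : (List α × List α) × List α => w.1.1 ++ w.2 = w.1.2 :=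
      PrimrecPred.to_re (Primrec.eq.comp
        (Primrec.list_append.comp (Primrec.fst.comp Primrec.fst) Primrec.snd)
        (Primrec.snd.comp Primrec.fst))
    exact REPred.exists (p := fun (p : List α × ℕ) t => p.1 ++ t = z p.2)
      (h1.comp (f := fun w : (List α × ℕ) × List α => ((w.1.1, z w.1.2), w.2))
        (((Computable.fst.comp Computable.fst).pair
          (hz.comp (Computable.snd.comp Computable.fst))).pair Computable.snd))
  exact LowerSemicomputable.tsum_nat (f := fun y k =>
    {p : List α × ℕ | p.1 <+: z p.2}.indicator (fun p => dyadicWeight p.2) (y, k))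
    ((lowerSemicomputable_dyadicWeight.comp Computable.snd).indicator h)

/-- Domination of the mixture for the constant sequence `xs`, which is positive at `xs`. -/
theorem IsUniversalSemimeasure.pos [Primcodable α] {m : List α → ℝ≥0∞}
    (hm : IsUniversalSemimeasure m) (xs : List α) : m xs ≠ 0 := by
  obtain ⟨c, hc, h⟩ := hm.dominates _ (isSemimeasure_prefixMixture fun _ => xs)
    (lowerSemicomputable_prefixMixture (Computable.const xs))
  have h0 := (mul_le_mul_right (dyadicWeight_le_prefixMixture (fun _ => xs) 0) (c : ℝ≥0∞)).trans
    (h xs)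
  intro h'
  rw [h', nonpos_iff_eq_zero, mul_eq_zero] at h0
  exact h0.elim (by exact_mod_cast hc.ne') (dyadicWeight_ne_zero 0)

end Mixture

section Noncomputability

theorem IsSemimeasure.ne_top {α : Type*} {w : List α → ℝ≥0∞} (hw : IsSemimeasure w)
    (xs : List α) : w xs ≠ ∞ :=
  ne_top_of_le_ne_top ENNReal.one_ne_top (hw.le_one xs)

variable {α : Type*} [MeasurableSpace α] {P₀ : Measure (ℕ → α)} {m : List α → ℝ≥0∞}

/-- The probability of the other strings of the same length. -/
noncomputable def otherProb (P₀ : Measure (ℕ → α)) (xs : List α) : ℝ≥0∞ :=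
  ∑' y, {p : List α × List α | p.2.length = p.1.length ∧ p.2 ≠ p.1}.indicator
    (fun p => stringProb P₀ p.2) (xs, y)

theorem lowerSemicomputable_otherProb [Primcodable α] (hP : LowerSemicomputable (stringProb P₀)) :
    LowerSemicomputable (otherProb P₀) := by
  classical
  have h : REPred fun p : List α × List α => p.2.length = p.1.length ∧ p.2 ≠ p.1 :=
    PrimrecPred.to_re (PrimrecPred.and
      (Primrec.eq.comp (Primrec.list_length.comp Primrec.snd)
        (Primrec.list_length.comp Primrec.fst))
      (PrimrecPred.not (Primrec.eq.comp Primrec.snd Primrec.fst)))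
  exact LowerSemicomputable.tsum (f := fun xs y =>
    {p : List α × List α | p.2.length = p.1.length ∧ p.2 ≠ p.1}.indicator
      (fun p => stringProb P₀ p.2) (xs, y)) ((hP.comp Computable.snd).indicator h)

variable [IsProbabilityMeasure P₀]

/-- This holds at null strings too: the ratio and its real inverse are both zero there. -/
theorem stringProb_eq_mul_inv_codeRatio {xs : List α} (h0 : m xs ≠ 0) (ht : m xs ≠ ∞) :
    stringProb P₀ xs = m xs * ENNReal.ofReal (codeRatio (logCode m) P₀ xs)⁻¹ := by
  have hp := stringProb_ne_top (P₀ := P₀) xs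
  rw [codeRatio_logCode, inv_div, ENNReal.ofReal_div_of_pos (ENNReal.toReal_pos h0 ht),
    ENNReal.ofReal_toReal hp, ENNReal.ofReal_toReal ht, ENNReal.mul_div_cancel h0 ht]

theorem lowerSemicomputable_stringProb [Primcodable α] (hm : LowerSemicomputable m)
    (h0 : ∀ xs, m xs ≠ 0) (ht : ∀ xs, m xs ≠ ∞) (hR : ComputableRealFun (codeRatio (logCode m) P₀)) :
    LowerSemicomputable (stringProb P₀) := by
  have := hm.mul (hR.lowerSemicomputable_inv fun xs => codeRatio_nonneg _ _)
  rwa [← funext fun xs => stringProb_eq_mul_inv_codeRatio (P₀ := P₀) (h0 xs) (ht xs)] at this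

variable [MeasurableSingletonClass α]

theorem stringProb_add_otherProb [Countable α] (xs : List α) :
    stringProb P₀ xs + otherProb P₀ xs = 1 := by
  classical
  rw [← tsum_stringProb_length (P₀ := P₀) xs.length, ENNReal.tsum_eq_add_tsum_ite xs,
    if_pos rfl, otherProb]
  congr 1
  refine tsum_congr fun y => ?_
  by_cases hy : y = xs <;> by_cases hl : y.length = xs.length <;> simp [hy, hl]

/-- Along a suitable path of positive null probability, a semimeasure loses arbitrarily little mass
at some symbol. -/
theorem IsSemimeasure.exists_lt_add [Countable α] (hm : IsSemimeasure m) {ε : ℝ≥0∞} (hε : ε ≠ 0) :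
    ∃ xs b, stringProb P₀ xs ≠ 0 ∧ m xs < ε + m (xs ++ [b]) := by
  by_contra! h
  -- If every step from a string of positive null probability lost at least `ε`, then `n` steps
  -- would lose `nε`, although the initial mass is at most one.
  have key : ∀ n : ℕ, ∃ xs, stringProb P₀ xs ≠ 0 ∧ n * ε + m xs ≤ 1 := by
    intro n
    induction n with
    | zero => exact ⟨[], by simp, by simpa using hm.1⟩
    | succ n ih =>
      obtain ⟨xs, h0, hle⟩ := ih
      obtain ⟨b, hb⟩ : ∃ b, stringProb P₀ (xs ++ [b]) ≠ 0 := by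
        by_contra! hb
        exact h0 (by rw [← tsum_stringProb_append, ENNReal.tsum_eq_zero.2 hb])
      refine ⟨xs ++ [b], hb, le_trans ?_ hle⟩
      rw [Nat.cast_succ, add_mul, one_mul, add_assoc]
      exact add_le_add_right (h xs b h0) _
  obtain ⟨n, hn⟩ := ENNReal.exists_nat_mul_gt hε ENNReal.one_ne_top
  obtain ⟨xs, -, hle⟩ := key n
  exact absurd (le_self_add.trans hle) (not_le.2 hn)

/-- If the ratio of a semimeasure and the null is computable, then strings of small semimeasure can
be found effectively. -/
theorem exists_computable_le [Primcodable α] [Nontrivial α] (hm : IsSemimeasure m)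
    (hls : LowerSemicomputable m) (h0 : ∀ xs, m xs ≠ 0) (hR : ComputableRealFun (codeRatio (logCode m) P₀))
    {ε : ℕ → ℝ≥0∞} (hε : LowerSemicomputable ε) (hε0 : ∀ k, ε k ≠ 0) :
    ∃ z : ℕ → List α, Computable z ∧ ∀ k, m (z k) ≤ ε k := by
  classical
  have hnn : ∀ xs, 0 ≤ codeRatio (logCode m) P₀ xs := fun xs => codeRatio_nonneg _ _
  have hRl := hR.lowerSemicomputable
  have hO := lowerSemicomputable_otherProb
    (lowerSemicomputable_stringProb hls h0 hm.ne_top hR)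
  let r : List α → ℝ≥0∞ := fun xs => ENNReal.ofReal (codeRatio (logCode m) P₀ xs)
  -- This is `m = r · (1 - otherProb)` without subtraction.
  have hr : ∀ xs, stringProb P₀ xs ≠ 0 → r xs = m xs + r xs * otherProb P₀ xs := by
    intro xs hxs
    conv_lhs => rw [← mul_one (r xs), ← stringProb_add_otherProb (P₀ := P₀) xs, mul_add,
      ofReal_codeRatio_mul (hm.ne_top xs) hxs]
  have hfin : ∀ xs, r xs * otherProb P₀ xs ≠ ∞ := fun xs =>
    ENNReal.mul_ne_top ENNReal.ofReal_ne_top (ne_top_of_le_ne_top ENNReal.one_ne_top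
      (le_add_self.trans (stringProb_add_otherProb xs).le))
  -- Adding `r · otherProb` to both sides turns the left one into the computable `r` and keeps the
  -- right one lower semicomputable, so the inequality becomes enumerable.
  have hlt : ∀ k xs b, stringProb P₀ xs ≠ 0 →
      (r xs < (ε k + m (xs ++ [b])) + r xs * otherProb P₀ xs ↔ m xs < ε k + m (xs ++ [b])) := by
    intro k xs b hxs
    conv_lhs => lhs; rw [hr xs hxs]
    exact ENNReal.add_lt_add_iff_right (hfin xs)
  have cx : Computable fun w : ℕ × (List α × α × α) => w.2.1 :=
    Computable.fst.comp Computable.snd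
  have ca : Computable fun w : ℕ × (List α × α × α) => w.2.2.1 :=
    Computable.fst.comp (Computable.snd.comp Computable.snd)
  have cb : Computable fun w : ℕ × (List α × α × α) => w.2.2.2 :=
    Computable.snd.comp (Computable.snd.comp Computable.snd)
  have cxb : Computable fun w : ℕ × (List α × α × α) => w.2.1 ++ [w.2.2.2] :=
    Computable.list_append.comp cx (Computable.list_cons.comp cb (Computable.const []))
  -- The condition `0 < r` is an enumerable substitute for positive null probability: it excludes
  -- null strings, and it holds at all others since `m` is positive.
  have hre : REPred fun w : ℕ × (List α × α × α) => w.2.2.1 ≠ w.2.2.2 ∧ 0 < r w.2.1 ∧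
      r w.2.1 < (ε w.1 + m (w.2.1 ++ [w.2.2.2])) + r w.2.1 * otherProb P₀ w.2.1 := by
    refine REPred.and ?_ (REPred.and ?_ ?_)
    · exact PrimrecPred.to_re (PrimrecPred.not (Primrec.eq.comp
        (Primrec.fst.comp (Primrec.snd.comp Primrec.snd))
        (Primrec.snd.comp (Primrec.snd.comp Primrec.snd))))
    · exact (hRl.comp cx).re_pos
    · exact (hR.comp cx).re_lt (fun w => hnn _)
        (((hε.comp Computable.fst).add (hls.comp cxb)).add ((hRl.comp cx).mul (hO.comp cx)))
  obtain ⟨f, hf, h⟩ := REPred.exists_computable (p := fun k (w : List α × α × α) =>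
    w.2.1 ≠ w.2.2 ∧ 0 < r w.1 ∧
      r w.1 < (ε k + m (w.1 ++ [w.2.2])) + r w.1 * otherProb P₀ w.1) hre (fun k => by
    obtain ⟨xs, b, hxs, hb⟩ := hm.exists_lt_add (P₀ := P₀) (hε0 k)
    obtain ⟨a, hab⟩ := exists_ne b
    refine ⟨(xs, a, b), hab, ?_, (hlt k xs b hxs).2 hb⟩
    have := ofReal_codeRatio_mul (hm.ne_top xs) hxs
    refine pos_iff_ne_zero.2 fun hz => h0 xs ?_
    rw [← this]
    exact mul_eq_zero_of_left hz _)
  refine ⟨fun k => (f k).1 ++ [(f k).2.1], Computable.list_append.comp (Computable.fst.comp hf)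
    (Computable.list_cons.comp (Computable.fst.comp (Computable.snd.comp hf))
      (Computable.const [])), fun k => ?_⟩
  obtain ⟨hne, hpos, hlt'⟩ := h k
  have hxs : stringProb P₀ (f k).1 ≠ 0 := by
    intro hz
    simp [r, codeRatio, hz] at hpos
  have h1 := (hlt k _ _ hxs).1 hlt'
  -- Two distinct extensions share the mass of their parent. Since one of them takes all but `ε k`,
  -- the other gets less than `ε k`.
  have h2 : m ((f k).1 ++ [(f k).2.1]) + m ((f k).1 ++ [(f k).2.2]) ≤ m (f k).1 := by
    have := ENNReal.sum_le_tsum (f := fun a => m ((f k).1 ++ [a])) {(f k).2.1, (f k).2.2}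
    rw [Finset.sum_pair hne] at this
    exact this.trans (hm.2 _)
  exact ((ENNReal.add_lt_add_iff_right (hm.ne_top _)).1 (h2.trans_lt h1)).le

theorem IsUniversalSemimeasure.not_computableRealFun_codeRatio [Primcodable α] [Nontrivial α]
    (hm : IsUniversalSemimeasure m) : ¬ ComputableRealFun (codeRatio (logCode m) P₀) := by
  intro hR
  have hfrac : LowerSemicomputable fun k => natFrac (1, k) :=
    Computable.lowerSemicomputable_natFrac ((Computable.const 1).pair Computable.id)
  -- The bound is the mixture weight times `1/(k + 1)`, so domination would give `c ≤ 1/(k + 1)` for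
  -- every `k`.
  obtain ⟨z, hz, hle⟩ := exists_computable_le hm.isSemimeasure hm.lowerSemicomputable hm.pos hR
    (hfrac.mul lowerSemicomputable_dyadicWeight)
    fun k => mul_ne_zero (by simp [natFrac]) (dyadicWeight_ne_zero k)
  obtain ⟨c, hc, h⟩ := hm.dominates _ (isSemimeasure_prefixMixture z)
    (lowerSemicomputable_prefixMixture hz)
  obtain ⟨k, hk⟩ := ENNReal.exists_inv_nat_lt (a := (c : ℝ≥0∞)) (by exact_mod_cast hc.ne')
  have h1 : (c : ℝ≥0∞) * dyadicWeight k ≤ natFrac (1, k) * dyadicWeight k :=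
    (mul_le_mul_right (dyadicWeight_le_prefixMixture z k) _).trans ((h (z k)).trans (hle k))
  have h2 : (c : ℝ≥0∞) ≤ natFrac (1, k) :=
    (ENNReal.mul_le_mul_iff_left (dyadicWeight_ne_zero k) (natFrac_ne_top _)).1 h1
  refine absurd (h2.trans ?_) (not_le.2 hk)
  rw [natFrac, Nat.cast_one, one_div, ENNReal.inv_le_inv]
  exact le_self_add

end Noncomputability

/-! ## The main theorem -/

theorem mainTheorem3 :
    -- (a) codes of probability measures
    (∀ (Ω : Type*) [MeasurableSpace Ω] (P : Measure Ω) [IsProbabilityMeasure P]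
        (α : Type*) [Countable α] [MeasurableSpace α] [MeasurableSingletonClass α]
        (X : ℕ → Ω → α) (hX : ∀ i, Measurable (X i))
        (P₀ : Measure (ℕ → α)) (_ : HasLaw (fun ω i => X i ω) P₀ P)
        (Q : Measure (ℕ → α)) [IsProbabilityMeasure Q]
        (ℓ : List α → EReal) (_ : ℓ = logCode (stringProb Q)),
        IsEProcess (codeProcess ℓ P₀ X) (dataFiltration X hX) P) ∧
    -- (b) the NML code of the Bernoulli model: the normalizing constant depends on the sample size,
    -- there is no sequential factorization, and the process is not a supermartingale
    ((∃ n, 1 ≤ n ∧ nmlNormalizer bernoulliSeq n ≠ nmlNormalizer bernoulliSeq (n + 1)) ∧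
      ¬ SequentiallyFactorizes (logCode (nml bernoulliSeq)) ∧
      (¬ Supermartingale (codeProcess (logCode (nml bernoulliSeq)) fairCoin fun i x => x i)
          (dataFiltration (fun i (x : ℕ → Bool) => x i) measurable_pi_apply) fairCoin) ∧
      ∀ (Ω : Type*) [MeasurableSpace Ω] (P : Measure Ω) [IsProbabilityMeasure P]
        (X : ℕ → Ω → Bool) (hX : ∀ i, Measurable (X i))
        (P₀ : Measure (ℕ → Bool)) (_ : HasLaw (fun ω i => X i ω) P₀ P)
        (_ : ∀ xs, 0 < stringProb P₀ xs),
        ¬ Supermartingale (codeProcess (logCode (nml bernoulliSeq)) P₀ X)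
          (dataFiltration X hX) P) ∧
    -- (c) the universal semimeasure
    (∀ (Ω : Type*) [MeasurableSpace Ω] (P : Measure Ω) [IsProbabilityMeasure P]
        (α : Type*) [Primcodable α] [Nontrivial α] [MeasurableSpace α] [MeasurableSingletonClass α]
        (X : ℕ → Ω → α) (hX : ∀ i, Measurable (X i))
        (P₀ : Measure (ℕ → α)) (_ : HasLaw (fun ω i => X i ω) P₀ P)
        (m : List α → ℝ≥0∞) (_ : IsUniversalSemimeasure m)
        (ℓ : List α → EReal) (_ : ℓ = logCode m),
        IsEProcess (codeProcess ℓ P₀ X) (dataFiltration X hX) P ∧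
          ¬ ComputableRealFun (codeRatio ℓ P₀)) := by
  refine ⟨?_, ⟨⟨2, by norm_num, nmlNormalizer_bernoulliSeq_two_ne_three⟩,
    not_sequentiallyFactorizes_nml_bernoulliSeq,
    not_supermartingale_nml_bernoulliSeq _ (hasLaw_coordinates _) stringProb_fairCoin_pos, ?_⟩, ?_⟩
  · rintro Ω _ P _ α _ _ _ X hX P₀ hlaw Q _ ℓ rfl
    have : IsProbabilityMeasure P₀ := hlaw.isProbabilityMeasure_iff.1 inferInstance
    exact isEProcess_codeProcess hX hlaw isSemimeasure_stringProb
  · intro Ω _ P _ X hX P₀ hlaw hpos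
    have : IsProbabilityMeasure P₀ := hlaw.isProbabilityMeasure_iff.1 inferInstance
    exact not_supermartingale_nml_bernoulliSeq hX hlaw hpos
  · rintro Ω _ P _ α _ _ _ _ X hX P₀ hlaw m hm ℓ rfl
    have : IsProbabilityMeasure P₀ := hlaw.isProbabilityMeasure_iff.1 inferInstance
    exact ⟨isEProcess_codeProcess hX hlaw hm.isSemimeasure, hm.not_computableRealFun_codeRatio⟩
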